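/- Let $E=(E^0,E^1,r,s)$ be a directed graph with countable vertex and edge sets that is locally finite (each vertex emits and receives at most finitely many edges) and has no sources (each vertex receives an edge). Let $E^*$ be the set of finite paths in $E$, with vertices as the paths of length $0$; write $|\mu|$, $r(\mu)$ for the length and range of a path $\mu$, and $|v|_k$ for the number of paths of length $k$ with range $v$. Let $A=C^*(E)$ be the graph $C^*$-algebra, universal for Cuntz–Krieger families $\{p_v,S_e\}$ ($p_v$ mutually orthogonal projections, $S_e$ partial isometries, $S_e^*S_e=p_{r(e)}$, and $p_v=\sum_{s(e)=v}S_eS_e^*$ whenever $v$ emits an edge); put $S_\mu=S_{\mu_1}\cdots S_{\mu_n}$ for a path $\mu=\mu_1\cdots\mu_n$ and $S_v=p_v$ for a vertex $v$. Let $\gamma$ be the gauge action of the circle on $A$ ($\gamma_z(S_e)=zS_e$, $\gamma_z(p_v)=p_v$), $F$ its fixed point algebra, $\Phi(a)=\frac1{2\pi}\int_0^{2\pi}\gamma_{e^{i\theta}}(a)\,d\theta$ the expectation of $A$ onto $F$, and $X_c=A_c=\operatorname{span}\{S_\mu S_\nu^*:\mu,\nu\in E^*,\ r(\mu)=r(\nu)\}$.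 Let $\tau:A_+\to[0,\infty]$ be a faithful, semifinite (that is, $\{a\in A_+:\tau(a)<\infty\}$ is norm dense in $A_+$), norm lower-semicontinuous, gauge invariant trace; it is finite on $A_c$, in the sense that $A_c\subset\operatorname{span}\{a\in A_+:\tau(a)<\infty\}$, and $\tau$ also denotes its linear extension to this span. Let $\mathcal H=L^2(X,\tau)$ be the completion of $X_c$ in the inner product $\langle x,y\rangle=\tau(x^*y)$. For $x,y\in X_c$ let $\Theta_{x,y}$ be the bounded operator on $\mathcal H$ with $\Theta_{x,y}z=x\,\Phi(y^*z)$ for $z\in X_c$, let $End^{00}_F(X_c)$ be the linear span of all $\Theta_{x,y}$, $x,y\in X_c$, and let $\mathcal N=(End^{00}_F(X_c))''\subset\mathcal B(\mathcal H)$. For $T\in\mathcal N$ and $\mu\in E^*$ put $$\omega_\mu(T)=\langle S_\mu,TS_\mu\rangle+\frac1{|r(\mu)|_{|\mu|}}\langle S_\mu^*,TS_\mu^*\rangle\ \text{ if }|\mu|\ne0,\qquad \omega_v(T)=\langle p_v,Tp_v\rangle\ \text{ for } v\in E^0,$$ and define $\tilde\tau:\mathcal N_+\to[0,\infty]$ by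 $\tilde\tau(T)=\sum_{\mu\in E^*}\omega_\mu(T)$, the limit of the sums over finite subsets of $E^*$. Then $\tilde\tau$ is a faithful normal semifinite trace on $\mathcal N$. Moreover $$End^{00}_F(X_c)\subset\mathcal N_{\tilde\tau}:=\operatorname{span}\{T\in\mathcal N_+:\tilde\tau(T)<\infty\},$$ and the linear extension of $\tilde\tau$ to $\mathcal N_{\tilde\tau}$ satisfies $$\tilde\tau(\Theta_{x,y})=\langle y,x\rangle=\tau(y^*x)\qquad\text{for all } x,y\in X_c.$$ -/

import Mathlib

open scoped ENNReal NNReal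

noncomputable section


universe u v

/-- A directed graph with vertex set `V`, edge set `E`, range map `rng` and source map `src`, that is
row-finite: each vertex emits at most finitely many edges. -/
structure RowFiniteGraph (V : Type u) (E : Type v) where
  rng : E → V
  src : E → V
  row_finite : ∀ v, {e | src e = v}.Finite

namespace RowFiniteGraph

variable {V : Type u} {E : Type v}

/-- Each vertex receives at most finitely many edges (and the graph is row-finite). -/
def LocallyFinite (G : RowFiniteGraph V E) : Prop :=
  ∀ v, {e | G.rng e = v}.Finite

/-- Each vertex receives at least one edge. -/
def NoSources (G : RowFiniteGraph V E) : Prop :=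
  ∀ v, ∃ e, G.rng e = v

/-! ### Paths -/

/-- `IsPathFrom v [μ₁, …, μₙ]`: `μ₁ ⋯ μₙ` is a path with source `v`. -/
def IsPathFrom (G : RowFiniteGraph V E) : V → List E → Prop
  | _, [] => True
  | v, e :: l => G.src e = v ∧ G.IsPathFrom (G.rng e) l

/-- The range of the path with source `v` and list of edges `l`. -/
def rangeFrom (G : RowFiniteGraph V E) : V → List E → V
  | v, [] => v
  | _, e :: l => G.rangeFrom (G.rng e) l

/-- The set `E^*` of finite paths. Vertices are the paths of length zero. -/
structure FinPath (G : RowFiniteGraph V E) where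
  source : V
  edges : List E
  isPath : G.IsPathFrom source edges

namespace FinPath

variable {G : RowFiniteGraph V E}

/-- The length `|μ|`. -/
def length (μ : G.FinPath) : ℕ := μ.edges.length

/-- The range `r(μ)`. -/
def range (μ : G.FinPath) : V := G.rangeFrom μ.source μ.edges

end FinPath

/-- `|v|_k`, the number of paths of length `k` with range `v`. -/
noncomputable def numPaths (G : RowFiniteGraph V E) (v : V) (k : ℕ) : ℕ :=
  Nat.card {μ : G.FinPath // μ.length = k ∧ μ.range = v}

/-! ### Cuntz–Krieger families and the graph algebra -/

/-- A Cuntz–Krieger `G`-family in a C⋆-algebra `B`. -/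
structure CKFamily (G : RowFiniteGraph V E) (B : Type*) [NonUnitalCStarAlgebra B] where
  p : V → B
  S : E → B
  isStarProjection_p : ∀ v, IsStarProjection (p v)
  p_mul_p : ∀ v w, v ≠ w → p v * p w = 0
  isPartialIsometry : ∀ e, S e * star (S e) * S e = S e
  star_S_mul_S : ∀ e, star (S e) * S e = p (G.rng e)
  p_eq_sum : ∀ v, (∃ e, G.src e = v) →
    p v = ∑ e ∈ (G.row_finite v).toFinset, S e * star (S e)

/-- A C⋆-algebra together with a Cuntz–Krieger `G`-family in it. (A C⋆-algebra generated by such a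
family is separable for a countable graph, hence it has a copy in `Type`.) -/
structure CKRep (G : RowFiniteGraph V E) where
  B : Type
  [cstar : NonUnitalCStarAlgebra B]
  fam : G.CKFamily B

attribute [instance] CKRep.cstar

lemma CKFamily.norm_p_le {G : RowFiniteGraph V E} {B : Type*} [NonUnitalCStarAlgebra B]
    (f : G.CKFamily B) (v : V) : ‖f.p v‖ ≤ 1 := by
  have h := CStarRing.norm_star_mul_self (x := f.p v)
  rw [(f.isStarProjection_p v).isSelfAdjoint.star_eq,
    (f.isStarProjection_p v).isIdempotentElem.eq] at h
  nlinarith [norm_nonneg (f.p v)]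

lemma CKFamily.norm_S_le {G : RowFiniteGraph V E} {B : Type*} [NonUnitalCStarAlgebra B]
    (f : G.CKFamily B) (e : E) : ‖f.S e‖ ≤ 1 := by
  have h := CStarRing.norm_star_mul_self (x := f.S e)
  rw [f.star_S_mul_S] at h
  nlinarith [norm_nonneg (f.S e), f.norm_p_le (G.rng e)]

/-- The C⋆-algebra of bounded families indexed by all Cuntz–Krieger families. -/
abbrev BoundedFamilies (G : RowFiniteGraph V E) : Type _ := lp (fun i : G.CKRep => i.B) ∞

/-- The family of all `p_v`. -/
def univP (G : RowFiniteGraph V E) (v : V) : G.BoundedFamilies :=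
  ⟨fun i => i.fam.p v, memℓp_infty ⟨1, by rintro _ ⟨i, rfl⟩; exact i.fam.norm_p_le v⟩⟩

/-- The family of all `S_e`. -/
def univS (G : RowFiniteGraph V E) (e : E) : G.BoundedFamilies :=
  ⟨fun i => i.fam.S e, memℓp_infty ⟨1, by rintro _ ⟨i, rfl⟩; exact i.fam.norm_S_le e⟩⟩

/-- The algebraic ⋆-algebra generated by the universal family. -/
def algPart (G : RowFiniteGraph V E) : NonUnitalStarSubalgebra ℂ G.BoundedFamilies :=
  NonUnitalStarAlgebra.adjoin ℂ (Set.range G.univP ∪ Set.range G.univS)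

/-- The universal C⋆-algebra `C^*(G)` generated by a Cuntz–Krieger `G`-family, realised as the
C⋆-algebra generated by the direct sum of all Cuntz–Krieger `G`-families. -/
def CStar (G : RowFiniteGraph V E) : Type _ := G.algPart.topologicalClosure

noncomputable instance (G : RowFiniteGraph V E) : NonUnitalCStarAlgebra G.CStar :=
  NonUnitalStarSubalgebra.nonUnitalCStarAlgebra G.algPart.topologicalClosure
    (h_closed := G.algPart.isClosed_topologicalClosure)

/-- The usual order: `0 ≤ a` iff `a` is selfadjoint with nonnegative spectrum. -/
noncomputable instance (G : RowFiniteGraph V E) : PartialOrder G.CStar :=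
  CStarAlgebra.spectralOrder _

instance (G : RowFiniteGraph V E) : StarOrderedRing G.CStar :=
  CStarAlgebra.spectralOrderedRing _

namespace CStar

variable (G : RowFiniteGraph V E)

/-- The inclusion into the bounded families. -/
def incl : G.CStar →⋆ₙₐ[ℂ] G.BoundedFamilies where
  toFun x := x.1
  map_smul' _ _ := rfl
  map_zero' := rfl
  map_add' _ _ := rfl
  map_mul' _ _ := rfl
  map_star' _ := rfl

variable {G} in
@[ext] lemma ext {a b : G.CStar} (h : ∀ i : G.CKRep, (incl G a).1 i = (incl G b).1 i) : a = b :=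
  Subtype.ext (Subtype.ext (funext h))

/-- The generating projection `p_v`. -/
def p (v : V) : G.CStar :=
  ⟨G.univP v, G.algPart.le_topologicalClosure
    (NonUnitalStarAlgebra.subset_adjoin _ _ (Or.inl ⟨v, rfl⟩))⟩

/-- The generating partial isometry `S_e`. -/
def S (e : E) : G.CStar :=
  ⟨G.univS e, G.algPart.le_topologicalClosure
    (NonUnitalStarAlgebra.subset_adjoin _ _ (Or.inr ⟨e, rfl⟩))⟩

/-- Evaluation at a Cuntz–Krieger family. -/
def eval (i : G.CKRep) : G.CStar →⋆ₙₐ[ℂ] i.B where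
  toFun x := (incl G x).1 i
  map_smul' _ _ := rfl
  map_zero' := rfl
  map_add' _ _ := rfl
  map_mul' _ _ := rfl
  map_star' _ := rfl

/-- The universal Cuntz–Krieger family. -/
def family : G.CKFamily G.CStar where
  p := p G
  S := S G
  isStarProjection_p v := ⟨ext fun i => (i.fam.isStarProjection_p v).isIdempotentElem,
    ext fun i => (i.fam.isStarProjection_p v).isSelfAdjoint⟩
  p_mul_p v w h := ext fun i => i.fam.p_mul_p v w h
  isPartialIsometry e := ext fun i => i.fam.isPartialIsometry e
  star_S_mul_S e := ext fun i => i.fam.star_S_mul_S e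
  p_eq_sum v h := ext fun i => by
    have h2 : eval G i (p G v) =
        eval G i (∑ e ∈ (G.row_finite v).toFinset, S G e * star (S G e)) := by
      rw [map_sum]
      exact i.fam.p_eq_sum v h
    exact h2

/-- The universal property of `C^*(G)`. -/
theorem exists_lift (B : Type) [NonUnitalCStarAlgebra B] (f : G.CKFamily B) :
    ∃ φ : G.CStar →⋆ₙₐ[ℂ] B, (∀ v, φ (p G v) = f.p v) ∧ ∀ e, φ (S G e) = f.S e :=
  ⟨eval G ⟨B, f⟩, fun _ => rfl, fun _ => rfl⟩

/-! ### The gauge action -/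

/-- The Cuntz–Krieger family `{z S_e, p_v}`. -/
def _root_.RowFiniteGraph.CKRep.rotate {G : RowFiniteGraph V E} (z : Circle) (i : G.CKRep) :
    G.CKRep where
  B := i.B
  fam :=
    { p := i.fam.p
      S := fun e => (z : ℂ) • i.fam.S e
      isStarProjection_p := i.fam.isStarProjection_p
      p_mul_p := i.fam.p_mul_p
      isPartialIsometry := fun e => by
        have hz : (z : ℂ) * (star (z : ℂ) * (z : ℂ)) = z := by
          simp [Complex.conj_mul', Circle.norm_coe]
        simp only [star_smul, smul_mul_assoc, mul_smul_comm, smul_smul, i.fam.isPartialIsometry]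
        rw [show (z : ℂ) * (star (z : ℂ) * (z : ℂ)) = z from hz]
      star_S_mul_S := fun e => by
        have hz : (star (z : ℂ) * (z : ℂ)) = 1 := by
          simp [Complex.conj_mul', Circle.norm_coe]
        simp only [star_smul, smul_mul_assoc, mul_smul_comm, smul_smul, i.fam.star_S_mul_S]
        rw [mul_comm, hz, one_smul]
      p_eq_sum := fun v h => by
        have hz : ((z : ℂ) * star (z : ℂ)) = 1 := by
          simp [Complex.mul_conj', Circle.norm_coe]
        rw [i.fam.p_eq_sum v h]
        refine Finset.sum_congr rfl fun e _ => ?_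
        simp only [star_smul, smul_mul_assoc, mul_smul_comm, smul_smul]
        rw [mul_comm, hz, one_smul] }

/-- Reindexing the bounded families along `{S_e, p_v} ↦ {z S_e, p_v}`. -/
def rotateFamilies (z : Circle) : G.BoundedFamilies →⋆ₙₐ[ℂ] G.BoundedFamilies where
  toFun x := ⟨fun i => x.1 (i.rotate z), by
    obtain ⟨C, hC⟩ := memℓp_infty_iff.1 x.2
    exact memℓp_infty ⟨C, by rintro _ ⟨i, rfl⟩; exact hC ⟨i.rotate z, rfl⟩⟩⟩
  map_smul' _ _ := rfl
  map_zero' := rfl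
  map_add' _ _ := rfl
  map_mul' _ _ := rfl
  map_star' _ := rfl

lemma rotateFamilies_mem (z : Circle) (x : G.BoundedFamilies)
    (hx : x ∈ G.algPart.topologicalClosure) :
    rotateFamilies G z x ∈ G.algPart.topologicalClosure := by
  have hc : Continuous (rotateFamilies G z) := by
    refine AddMonoidHomClass.continuous_of_bound (rotateFamilies G z) 1 fun x => ?_
    rw [one_mul]
    exact NonUnitalStarAlgHom.norm_apply_le _ x
  have h1 : G.algPart.map (rotateFamilies G z) ≤ G.algPart := by
    rw [algPart, NonUnitalStarAlgHom.map_adjoin]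
    refine NonUnitalStarAlgebra.adjoin_le ?_
    rintro _ ⟨_, ⟨v, rfl⟩ | ⟨e, rfl⟩, rfl⟩
    · exact NonUnitalStarAlgebra.subset_adjoin _ _ (Or.inl ⟨v, rfl⟩)
    · have : rotateFamilies G z (G.univS e) = (z : ℂ) • G.univS e := rfl
      rw [this]
      exact SMulMemClass.smul_mem _
        (NonUnitalStarAlgebra.subset_adjoin _ _ (Or.inr ⟨e, rfl⟩))
  have h2 := NonUnitalStarSubalgebra.map_topologicalClosure_le (s := G.algPart) hc
  exact NonUnitalStarSubalgebra.topologicalClosure_mono h1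
    (h2 ⟨x, hx, rfl⟩)

/-- The gauge action: `γ_z (S_e) = z S_e` and `γ_z (p_v) = p_v`. -/
def gauge (z : Circle) : G.CStar →⋆ₙₐ[ℂ] G.CStar where
  toFun x := ⟨rotateFamilies G z x.1, rotateFamilies_mem G z x.1 x.2⟩
  map_smul' _ _ := rfl
  map_zero' := rfl
  map_add' _ _ := rfl
  map_mul' _ _ := rfl
  map_star' _ := rfl

lemma gauge_p (z : Circle) (v : V) : gauge G z (p G v) = p G v := rfl

lemma gauge_S (z : Circle) (e : E) : gauge G z (S G e) = (z : ℂ) • S G e := rfl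

/-- The expectation `Φ(a) = (1/2π) ∫ γ_z(a) dθ`, `z = e^{iθ}`. -/
noncomputable def expect (a : G.CStar) : G.CStar :=
  (2 * Real.pi)⁻¹ • ∫ θ in (0 : ℝ)..(2 * Real.pi), gauge G (Circle.exp θ) a

end CStar
end RowFiniteGraph

/-! ### Traces -/

/-- The positive cone of an ordered vector space. -/
abbrev PosCone (A : Type*) [Zero A] [LE A] : Type _ := {a : A // 0 ≤ a}

section Trace

variable {A : Type*} [NonUnitalRing A] [StarRing A] [Module ℂ A] [PartialOrder A]

/-- `φ : A₊ → [0, ∞]` is a trace: it is additive, positively homogeneous (with `0 · ∞ = 0`), and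
`φ(x^* x) = φ(x x^*)`. -/
structure IsTrace (φ : PosCone A → ℝ≥0∞) : Prop where
  additive : ∀ a b c : PosCone A, (c : A) = a + b → φ c = φ a + φ b
  homogeneous : ∀ (r : ℝ≥0) (a c : PosCone A), (c : A) = ((r : ℝ) : ℂ) • (a : A) → φ c = r * φ a
  tracial : ∀ (x : A) (a b : PosCone A), (a : A) = star x * x → (b : A) = x * star x → φ a = φ b

/-- `φ` is faithful. -/
def IsFaithfulWeight (φ : PosCone A → ℝ≥0∞) : Prop := ∀ a, φ a = 0 → (a : A) = 0

/-- The domain of definition of `φ`: the span of `{a ∈ A₊ : φ(a) < ∞}`. -/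
def weightDomain (φ : PosCone A → ℝ≥0∞) : Submodule ℂ A :=
  Submodule.span ℂ {a | ∃ h : 0 ≤ a, φ ⟨a, h⟩ < ⊤}

/-- `c` is the value at `a = a₀ - a₁ + i (a₂ - a₃)`, with `aⱼ` positive and `φ(aⱼ) < ∞`, of the
linear extension of `φ`. -/
def HasWeightValue (φ : PosCone A → ℝ≥0∞) (a : A) (c : ℂ) : Prop :=
  ∃ a₀ a₁ a₂ a₃ : PosCone A, φ a₀ < ⊤ ∧ φ a₁ < ⊤ ∧ φ a₂ < ⊤ ∧ φ a₃ < ⊤ ∧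
    a = ((a₀ : A) - a₁) + Complex.I • ((a₂ : A) - a₃) ∧
    c = (((φ a₀).toReal - (φ a₁).toReal : ℝ) : ℂ) +
      Complex.I * (((φ a₂).toReal - (φ a₃).toReal : ℝ) : ℂ)

open Classical in
/-- The linear extension of `φ` to its domain of definition (and zero elsewhere). -/
def weightExt (φ : PosCone A → ℝ≥0∞) (a : A) : ℂ :=
  if h : ∃ c, HasWeightValue φ a c then h.choose else 0

end Trace

/-- A trace on a C⋆-algebra is semifinite (densely defined) if `{a ∈ A₊ : φ(a) < ∞}` is norm dense
in `A₊`. -/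
def IsDenselyDefined {A : Type*} [NonUnitalCStarAlgebra A] [PartialOrder A]
    (φ : PosCone A → ℝ≥0∞) : Prop :=
  Dense {a : PosCone A | φ a < ⊤}

section TraceLemmas

variable {A : Type*} [NonUnitalCStarAlgebra A] [PartialOrder A] [StarOrderedRing A]
  {φ : PosCone A → ℝ≥0∞}

lemma real_smul_nonneg {r : ℝ} (hr : 0 ≤ r) {a : A} (ha : 0 ≤ a) : 0 ≤ (r : ℂ) • a := by
  have : (r : ℂ) • a = r • a := by simp
  rw [this]
  exact smul_nonneg hr ha

namespace IsTrace

lemma mono (h : IsTrace φ) {a b : PosCone A} (hab : (a : A) ≤ b) : φ a ≤ φ b := by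
  rw [h.additive a ⟨(b : A) - a, sub_nonneg.2 hab⟩ b (by simp)]
  exact le_self_add

lemma apply_zero (h : IsTrace φ) : φ ⟨0, le_rfl⟩ = 0 := by
  have := h.homogeneous 0 ⟨0, le_rfl⟩ ⟨0, le_rfl⟩ (by simp)
  simpa using this

lemma hasWeightValue_of_nonneg (h : IsTrace φ) (a : PosCone A) (ha : φ a < ⊤) :
    HasWeightValue φ a ((φ a).toReal : ℂ) :=
  ⟨a, ⟨0, le_rfl⟩, ⟨0, le_rfl⟩, ⟨0, le_rfl⟩, ha, by simp [h.apply_zero], by simp [h.apply_zero],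
    by simp [h.apply_zero], by simp, by simp [h.apply_zero]⟩

lemma hasWeightValue_add (h : IsTrace φ) {a b : A} {c d : ℂ} (ha : HasWeightValue φ a c)
    (hb : HasWeightValue φ b d) : HasWeightValue φ (a + b) (c + d) := by
  obtain ⟨a₀, a₁, a₂, a₃, h0, h1, h2, h3, rfl, rfl⟩ := ha
  obtain ⟨b₀, b₁, b₂, b₃, k0, k1, k2, k3, rfl, rfl⟩ := hb
  have key : ∀ x y : PosCone A, φ ⟨x.1 + y.1, add_nonneg x.2 y.2⟩ = φ x + φ y :=
    fun x y => h.additive x y _ rfl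
  refine ⟨⟨_, add_nonneg a₀.2 b₀.2⟩, ⟨_, add_nonneg a₁.2 b₁.2⟩, ⟨_, add_nonneg a₂.2 b₂.2⟩,
    ⟨_, add_nonneg a₃.2 b₃.2⟩, ?_, ?_, ?_, ?_, ?_, ?_⟩
  · rw [key]; exact ENNReal.add_lt_top.2 ⟨h0, k0⟩
  · rw [key]; exact ENNReal.add_lt_top.2 ⟨h1, k1⟩
  · rw [key]; exact ENNReal.add_lt_top.2 ⟨h2, k2⟩
  · rw [key]; exact ENNReal.add_lt_top.2 ⟨h3, k3⟩
  · module
  · rw [key, key, key, key, ENNReal.toReal_add h0.ne k0.ne, ENNReal.toReal_add h1.ne k1.ne,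
      ENNReal.toReal_add h2.ne k2.ne, ENNReal.toReal_add h3.ne k3.ne]
    push_cast
    ring

lemma hasWeightValue_I_smul {a : A} {c : ℂ} (ha : HasWeightValue φ a c) :
    HasWeightValue φ (Complex.I • a) (Complex.I * c) := by
  obtain ⟨a₀, a₁, a₂, a₃, h0, h1, h2, h3, rfl, rfl⟩ := ha
  refine ⟨a₃, a₂, a₀, a₁, h3, h2, h0, h1, ?_, ?_⟩
  · rw [smul_add, smul_smul, Complex.I_mul_I]
    module
  · push_cast
    linear_combination
      (((φ a₂).toReal : ℂ) - ((φ a₃).toReal : ℂ)) * Complex.I_mul_I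

lemma hasWeightValue_nnreal_smul (h : IsTrace φ) (r : ℝ≥0) {a : A} {c : ℂ}
    (ha : HasWeightValue φ a c) :
    HasWeightValue φ (((r : ℝ) : ℂ) • a) (((r : ℝ) : ℂ) * c) := by
  obtain ⟨a₀, a₁, a₂, a₃, h0, h1, h2, h3, rfl, rfl⟩ := ha
  have key : ∀ x : PosCone A, φ ⟨((r : ℝ) : ℂ) • x.1, real_smul_nonneg r.coe_nonneg x.2⟩ = r * φ x :=
    fun x => h.homogeneous r x _ rfl
  refine ⟨⟨_, real_smul_nonneg r.coe_nonneg a₀.2⟩, ⟨_, real_smul_nonneg r.coe_nonneg a₁.2⟩,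
    ⟨_, real_smul_nonneg r.coe_nonneg a₂.2⟩, ⟨_, real_smul_nonneg r.coe_nonneg a₃.2⟩, ?_, ?_, ?_, ?_, ?_, ?_⟩
  · rw [key]; exact ENNReal.mul_lt_top ENNReal.coe_lt_top h0
  · rw [key]; exact ENNReal.mul_lt_top ENNReal.coe_lt_top h1
  · rw [key]; exact ENNReal.mul_lt_top ENNReal.coe_lt_top h2
  · rw [key]; exact ENNReal.mul_lt_top ENNReal.coe_lt_top h3
  · module
  · rw [key, key, key, key]
    simp only [ENNReal.toReal_mul, ENNReal.coe_toReal]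
    push_cast
    ring

lemma hasWeightValue_neg {a : A} {c : ℂ} (ha : HasWeightValue φ a c) :
    HasWeightValue φ (-a) (-c) := by
  have := hasWeightValue_I_smul (hasWeightValue_I_smul ha)
  rwa [smul_smul, ← mul_assoc, Complex.I_mul_I, neg_one_smul, neg_one_mul] at this

lemma hasWeightValue_smul (h : IsTrace φ) (z : ℂ) {a : A} {c : ℂ}
    (ha : HasWeightValue φ a c) : HasWeightValue φ (z • a) (z * c) := by
  have hr : ∀ (r : ℝ) {a : A} {c : ℂ}, HasWeightValue φ a c →
      HasWeightValue φ ((r : ℂ) • a) ((r : ℂ) * c) := by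
    intro r a c ha
    rcases le_total 0 r with hr | hr
    · have := h.hasWeightValue_nnreal_smul r.toNNReal ha
      rwa [Real.coe_toNNReal r hr] at this
    · have := hasWeightValue_neg (h.hasWeightValue_nnreal_smul (-r).toNNReal ha)
      rw [Real.coe_toNNReal (-r) (neg_nonneg.2 hr), ← neg_smul, ← neg_mul] at this
      simpa using this
  have := h.hasWeightValue_add (hr z.re ha) (hasWeightValue_I_smul (hr z.im ha))
  rw [smul_smul, ← add_smul, ← mul_assoc, ← add_mul, mul_comm Complex.I, Complex.re_add_im] at this
  exact this

lemma hasWeightValue_star {a : A} {c : ℂ} (ha : HasWeightValue φ a c) :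
    HasWeightValue φ (star a) (star c) := by
  obtain ⟨a₀, a₁, a₂, a₃, h0, h1, h2, h3, rfl, rfl⟩ := ha
  refine ⟨a₀, a₁, a₃, a₂, h0, h1, h3, h2, ?_, ?_⟩
  · simp only [star_add, star_sub, star_smul, (IsSelfAdjoint.of_nonneg a₀.2).star_eq,
      (IsSelfAdjoint.of_nonneg a₁.2).star_eq, (IsSelfAdjoint.of_nonneg a₂.2).star_eq,
      (IsSelfAdjoint.of_nonneg a₃.2).star_eq, Complex.star_def, Complex.conj_I]
    module
  · simp only [star_add, star_mul', Complex.star_def, Complex.conj_I, Complex.conj_ofReal]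
    push_cast
    ring

lemma hasWeightValue_unique (h : IsTrace φ) {a : A} {c d : ℂ} (ha : HasWeightValue φ a c)
    (hb : HasWeightValue φ a d) : c = d := by
  obtain ⟨a₀, a₁, a₂, a₃, h0, h1, h2, h3, rfl, rfl⟩ := ha
  obtain ⟨b₀, b₁, b₂, b₃, k0, k1, k2, k3, e, rfl⟩ := hb
  have es := congrArg star e
  simp only [star_add, star_sub, star_smul, (IsSelfAdjoint.of_nonneg a₀.2).star_eq,
      (IsSelfAdjoint.of_nonneg a₁.2).star_eq, (IsSelfAdjoint.of_nonneg a₂.2).star_eq,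
      (IsSelfAdjoint.of_nonneg a₃.2).star_eq, (IsSelfAdjoint.of_nonneg b₀.2).star_eq,
      (IsSelfAdjoint.of_nonneg b₁.2).star_eq, (IsSelfAdjoint.of_nonneg b₂.2).star_eq,
      (IsSelfAdjoint.of_nonneg b₃.2).star_eq, Complex.star_def, Complex.conj_I] at es
  have e1 : (a₀ : A) - a₁ = b₀ - b₁ := by
    have : (2 : ℂ) • ((a₀ : A) - a₁) = (2 : ℂ) • ((b₀ : A) - b₁) := by
      have e3 := congrArg₂ (· + ·) e es
      have l : ∀ x y : A, (2 : ℂ) • x = (x + Complex.I • y) + (x + (-Complex.I) • y) := by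
        intro x y; module
      rw [l _ ((a₂ : A) - a₃), l _ ((b₂ : A) - b₃)]
      exact e3
    exact smul_right_injective A (two_ne_zero' ℂ) this
  have e2 : (a₂ : A) - a₃ = b₂ - b₃ := by
    rw [e1] at e
    exact smul_right_injective A Complex.I_ne_zero (add_left_cancel e)
  have key : ∀ x y z w : PosCone A, φ x < ⊤ → φ y < ⊤ → φ z < ⊤ → φ w < ⊤ →
      (x : A) - y = z - w →
      (φ x).toReal - (φ y).toReal = (φ z).toReal - (φ w).toReal := by
    intro x y z w hx hy hz hw hxy
    have h1 := h.additive x w ⟨_, add_nonneg x.2 w.2⟩ rfl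
    have h2 := h.additive z y ⟨(x : A) + w, add_nonneg x.2 w.2⟩
      (sub_eq_sub_iff_add_eq_add.1 hxy)
    have h3 := congrArg ENNReal.toReal (h1.symm.trans h2)
    rw [ENNReal.toReal_add hx.ne hw.ne, ENNReal.toReal_add hz.ne hy.ne] at h3
    linarith
  rw [key a₀ a₁ b₀ b₁ h0 h1 k0 k1 e1, key a₂ a₃ b₂ b₃ h2 h3 k2 k3 e2]

lemma weightExt_eq (h : IsTrace φ) {a : A} {c : ℂ} (ha : HasWeightValue φ a c) :
    weightExt φ a = c := by
  have hex : ∃ c, HasWeightValue φ a c := ⟨c, ha⟩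
  rw [weightExt, dif_pos hex]
  exact h.hasWeightValue_unique hex.choose_spec ha

/-- `φ(x^* x) < ∞`. -/
def SqFinite (φ : PosCone A → ℝ≥0∞) (x : A) : Prop :=
  φ ⟨star x * x, star_mul_self_nonneg x⟩ < ⊤

lemma sqFinite_of_le (h : IsTrace φ) {x : A} (a : PosCone A) (ha : φ a < ⊤)
    (hx : star x * x ≤ a) : SqFinite φ x :=
  (h.mono (a := ⟨star x * x, star_mul_self_nonneg x⟩) hx).trans_lt ha

lemma sqFinite_smul (h : IsTrace φ) (z : ℂ) {x : A} (hx : SqFinite φ x) :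
    SqFinite φ (z • x) := by
  have key := h.homogeneous (‖z‖₊ ^ 2) ⟨star x * x, star_mul_self_nonneg x⟩
    ⟨star (z • x) * (z • x), star_mul_self_nonneg _⟩ (by
      simp only [star_smul, smul_mul_assoc, mul_smul_comm, smul_smul]
      congr 1
      rw [Complex.star_def, Complex.mul_conj']
      push_cast
      rfl)
  rw [SqFinite, key]
  exact ENNReal.mul_lt_top ENNReal.coe_lt_top hx

lemma sqFinite_add (h : IsTrace φ) {x y : A} (hx : SqFinite φ x) (hy : SqFinite φ y) :
    SqFinite φ (x + y) := by
  have k1 := h.additive ⟨star x * x, star_mul_self_nonneg x⟩ ⟨star y * y, star_mul_self_nonneg y⟩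
    ⟨star x * x + star y * y, add_nonneg (star_mul_self_nonneg x) (star_mul_self_nonneg y)⟩ rfl
  have hlt : φ ⟨star x * x + star y * y,
      add_nonneg (star_mul_self_nonneg x) (star_mul_self_nonneg y)⟩ < ⊤ := by
    rw [k1]; exact ENNReal.add_lt_top.2 ⟨hx, hy⟩
  have k2 := h.additive _ _ ⟨(star x * x + star y * y) + (star x * x + star y * y),
    add_nonneg (add_nonneg (star_mul_self_nonneg x) (star_mul_self_nonneg y))
      (add_nonneg (star_mul_self_nonneg x) (star_mul_self_nonneg y))⟩
      (rfl : _ = (⟨star x * x + star y * y,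
      add_nonneg (star_mul_self_nonneg x) (star_mul_self_nonneg y)⟩ : PosCone A).1 +
      (⟨star x * x + star y * y,
      add_nonneg (star_mul_self_nonneg x) (star_mul_self_nonneg y)⟩ : PosCone A).1)
  refine h.sqFinite_of_le _ (by rw [k2]; exact ENNReal.add_lt_top.2 ⟨hlt, hlt⟩) ?_
  have := star_mul_self_nonneg (x - y)
  rw [← sub_nonneg]
  convert this using 1
  simp only [star_add, star_sub, add_mul, mul_add, sub_mul, mul_sub]
  abel

lemma sqFinite_star (h : IsTrace φ) {x : A} (hx : SqFinite φ x) : SqFinite φ (star x) := by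
  have := h.tracial x ⟨_, star_mul_self_nonneg x⟩ ⟨star (star x) * star x,
    star_mul_self_nonneg (star x)⟩ rfl (by simp)
  rw [SqFinite, ← this]
  exact hx

lemma star_mul_mul_le (a x : A) :
    star (a * x) * (a * x) ≤ ((‖a‖ ^ 2 : ℝ) : ℂ) • (star x * x) := by
  have := CStarAlgebra.star_left_conjugate_le_norm_smul (a := x) (b := star a * a)
    (IsSelfAdjoint.star_mul_self a)
  rw [CStarRing.norm_star_mul_self, ← sq] at this
  simpa only [star_mul, mul_assoc, Complex.coe_smul] using this

lemma sq_mul_le (h : IsTrace φ) (a x : A) :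
    φ ⟨star (a * x) * (a * x), star_mul_self_nonneg _⟩ ≤
      ((‖a‖₊ ^ 2 : ℝ≥0) : ℝ≥0∞) * φ ⟨star x * x, star_mul_self_nonneg x⟩ := by
  rw [← h.homogeneous (‖a‖₊ ^ 2) ⟨star x * x, star_mul_self_nonneg x⟩
    ⟨_, real_smul_nonneg (NNReal.coe_nonneg _) (star_mul_self_nonneg x)⟩ rfl]
  refine h.mono ?_
  simpa using star_mul_mul_le a x

lemma sqFinite_mul_left (h : IsTrace φ) (a : A) {x : A} (hx : SqFinite φ x) :
    SqFinite φ (a * x) :=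
  (h.sq_mul_le a x).trans_lt (ENNReal.mul_lt_top ENNReal.coe_lt_top hx)

lemma sqFinite_mul_right (h : IsTrace φ) {x : A} (a : A) (hx : SqFinite φ x) :
    SqFinite φ (x * a) := by
  have := h.sqFinite_star (h.sqFinite_mul_left (star a) (h.sqFinite_star hx))
  simpa using this

lemma exists_hasWeightValue (h : IsTrace φ) {x y : A} (hx : SqFinite φ x) (hy : SqFinite φ y) :
    ∃ c, HasWeightValue φ (star x * y) c := by
  have hv : ∀ {x : A}, SqFinite φ x → ∃ c, HasWeightValue φ (star x * x) c :=
    fun {x} hx => ⟨_, h.hasWeightValue_of_nonneg ⟨star x * x, star_mul_self_nonneg x⟩ hx⟩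
  obtain ⟨c0, h0⟩ := hv (h.sqFinite_add hx hy)
  obtain ⟨c1, h1⟩ := hv (h.sqFinite_add hx (h.sqFinite_smul (-1) hy))
  obtain ⟨c2, h2⟩ := hv (h.sqFinite_add hx (h.sqFinite_smul Complex.I hy))
  obtain ⟨c3, h3⟩ := hv (h.sqFinite_add hx (h.sqFinite_smul (-Complex.I) hy))
  have := h.hasWeightValue_add
    (h.hasWeightValue_add (h.hasWeightValue_smul (1 / 4) h0)
      (h.hasWeightValue_smul (-1 / 4) h1))
    (h.hasWeightValue_add (h.hasWeightValue_smul (-Complex.I / 4) h2)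
      (h.hasWeightValue_smul (Complex.I / 4) h3))
  refine ⟨_, (congrArg (fun t => HasWeightValue φ t _) ?_).mp this⟩
  simp only [star_add, star_smul, add_mul, mul_add, smul_mul_assoc, mul_smul_comm, smul_smul,
    smul_add, star_neg, star_one, Complex.star_def, Complex.conj_I]
  match_scalars <;> ring_nf <;> simp [Complex.I_sq] <;> ring_nf

/-- A densely defined trace is finite on projections. -/
lemma sqFinite_projection (h : IsTrace φ) (hd : IsDenselyDefined φ) {p : A}
    (hp : IsStarProjection p) : SqFinite φ p := by
  have hps : star p = p := hp.isSelfAdjoint.star_eq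
  have hpp : p * p = p := hp.isIdempotentElem.eq
  have hp0 : 0 ≤ p := by rw [← hpp]; nth_rewrite 1 [← hps]; exact star_mul_self_nonneg p
  obtain ⟨a, ha, hdist⟩ := Metric.dense_iff.1 hd ⟨p, hp0⟩ (1 / 2) (by norm_num)
  have hnorm : ‖p - (a : A)‖ ≤ 1 / 2 := by
    have : dist (a : A) p < 1 / 2 := ha
    rw [dist_eq_norm, norm_sub_rev] at this
    exact this.le
  have hsa : IsSelfAdjoint (p - (a : A)) := hp.isSelfAdjoint.sub (IsSelfAdjoint.of_nonneg a.2)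
  set s := CFC.sqrt (a : A) with hs
  have hs0 : 0 ≤ s := CFC.sqrt_nonneg _
  have hss : star s = s := (IsSelfAdjoint.of_nonneg hs0).star_eq
  have hs2 : s * s = a := CFC.sqrt_mul_sqrt_self (a : A) a.2
  have hsf : SqFinite φ s := by
    have : (⟨star s * s, star_mul_self_nonneg s⟩ : PosCone A) = a :=
      Subtype.ext ((congrArg (· * s) hss).trans hs2)
    rw [SqFinite, this]
    exact hdist
  have h2 : SqFinite φ (((2 : ℝ) : ℂ) • (s * p)) := h.sqFinite_smul _ (h.sqFinite_mul_right p hsf)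
  refine h.sqFinite_of_le ⟨_, star_mul_self_nonneg _⟩ h2 ?_
  have k := CStarAlgebra.star_left_conjugate_le_norm_smul (a := p) hsa
  rw [hps, hpp, mul_sub, sub_mul, hpp, hpp] at k
  have k2 : ‖p - (a : A)‖ • p ≤ (1 / 2 : ℝ) • p := smul_le_smul_of_nonneg_right hnorm hp0
  have k3 : (1 / 2 : ℝ) • p ≤ p * a * p := by
    have := k.trans k2
    rw [sub_le_comm] at this
    refine le_trans (le_of_eq ?_) this
    module
  have hpap : 0 ≤ p * a * p := (smul_nonneg (by norm_num) hp0).trans k3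
  have e : star (((2 : ℝ) : ℂ) • (s * p)) * (((2 : ℝ) : ℂ) • (s * p)) = (4 : ℝ) • (p * a * p) := by
    simp only [star_smul, smul_mul_assoc, mul_smul_comm, smul_smul, star_mul, hps, hss, ← hs2,
      mul_assoc]
    rw [← Complex.coe_smul]
    congr 1
    simp
    norm_num
  change star p * p ≤ star (((2 : ℝ) : ℂ) • (s * p)) * (((2 : ℝ) : ℂ) • (s * p))
  rw [e, hps, hpp]
  calc p = (2 : ℝ) • ((1 / 2 : ℝ) • p) := by module
    _ ≤ (2 : ℝ) • (p * a * p) := smul_le_smul_of_nonneg_left k3 (by norm_num)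
    _ ≤ (4 : ℝ) • (p * a * p) := smul_le_smul_of_nonneg_right (by norm_num) hpap

end IsTrace

end TraceLemmas

namespace RowFiniteGraph

variable {V : Type u} {E : Type v}

namespace CStar

variable (G : RowFiniteGraph V E)

/-! ### The dense subalgebra `A_c` -/

/-- `S_{μ₁} ⋯ S_{μₙ} p_{r(μₙ)} = S_{μ₁} ⋯ S_{μₙ}`, and `p_v` for the empty list. -/
def word : V → List E → G.CStar
  | v, [] => p G v
  | _, e :: l => S G e * word (G.rng e) l

/-- `S_μ = S_{μ₁} ⋯ S_{μₙ}` for a path `μ`, and `S_v = p_v` for a vertex `v`. -/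
def path (μ : G.FinPath) : G.CStar := word G μ.source μ.edges

/-- `A_c`, the finite linear span of the generators `S_μ S_ν^*`, `r(μ) = r(ν)`. -/
def Ac : Submodule ℂ G.CStar :=
  Submodule.span ℂ {a | ∃ μ ν : G.FinPath, μ.range = ν.range ∧ a = path G μ * star (path G ν)}

lemma p_star (v : V) : star (p G v) = p G v :=
  ((family G).isStarProjection_p v).isSelfAdjoint.star_eq

lemma p_sq (v : V) : p G v * p G v = p G v :=
  ((family G).isStarProjection_p v).isIdempotentElem.eq

lemma p_orth {v w : V} (h : v ≠ w) : p G v * p G w = 0 := (family G).p_mul_p v w h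

lemma star_S_mul_S (e : E) : star (S G e) * S G e = p G (G.rng e) := (family G).star_S_mul_S e

lemma S_mul_p (e : E) : S G e * p G (G.rng e) = S G e := by
  rw [← star_S_mul_S, ← mul_assoc]
  exact (family G).isPartialIsometry e

lemma isStarProjection_S_star (e : E) : IsStarProjection (S G e * star (S G e)) :=
  ⟨by
    rw [IsIdempotentElem, ← mul_assoc]
    exact congrArg (· * star (S G e)) ((family G).isPartialIsometry e),
    IsSelfAdjoint.mul_star_self _⟩

/-- Projections with sum a projection are mutually orthogonal. -/
lemma orth_of_sum {B ι : Type*} [NonUnitalCStarAlgebra B] (s : Finset ι) (q : ι → B)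
    (hq : ∀ i ∈ s, IsStarProjection (q i)) (hs : IsStarProjection (∑ i ∈ s, q i))
    {i j : ι} (hi : i ∈ s) (hj : j ∈ s) (hij : i ≠ j) : q i * q j = 0 := by
  let _ : PartialOrder B := CStarAlgebra.spectralOrder B
  have _ : StarOrderedRing B := CStarAlgebra.spectralOrderedRing B
  classical
  have hnn : ∀ (k : ι), k ∈ s → 0 ≤ star (q k * q j) * (q k * q j) :=
    fun k _ => star_mul_self_nonneg _
  have hk : ∀ k ∈ s, star (q k * q j) * (q k * q j) = q j * q k * q j := by
    intro k hk
    rw [star_mul, (hq k hk).isSelfAdjoint.star_eq, (hq j hj).isSelfAdjoint.star_eq]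
    simp only [mul_assoc]
    rw [← mul_assoc (q k) (q k), (hq k hk).isIdempotentElem.eq]
  set P := ∑ i ∈ s, q i with hP
  -- `q_j P q_j ≤ q_j`
  have h1 : q j * P * q j ≤ q j := by
    have := CStarAlgebra.star_left_conjugate_le_norm_smul (a := q j) hs.isSelfAdjoint
    rw [(hq j hj).isSelfAdjoint.star_eq, (hq j hj).isIdempotentElem.eq] at this
    refine this.trans ?_
    have hn : ‖P‖ ≤ 1 := by
      have h := CStarRing.norm_star_mul_self (x := P)
      rw [hs.isSelfAdjoint.star_eq, hs.isIdempotentElem.eq] at h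
      nlinarith [norm_nonneg P]
    have hqj : 0 ≤ q j := by
      rw [← (hq j hj).isIdempotentElem.eq]
      nth_rewrite 1 [← (hq j hj).isSelfAdjoint.star_eq]
      exact star_mul_self_nonneg _
    calc ‖P‖ • q j ≤ (1 : ℝ) • q j := smul_le_smul_of_nonneg_right hn hqj
      _ = q j := one_smul _ _
  have h2 : q j * P * q j = q j + ∑ k ∈ s.erase j, star (q k * q j) * (q k * q j) := by
    rw [hP, Finset.mul_sum, Finset.sum_mul, ← Finset.add_sum_erase s _ hj]
    congr 1
    · rw [(hq j hj).isIdempotentElem.eq, (hq j hj).isIdempotentElem.eq]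
    · exact Finset.sum_congr rfl fun k hk' => (hk k (Finset.mem_of_mem_erase hk')).symm
  have h3 : ∑ k ∈ s.erase j, star (q k * q j) * (q k * q j) = 0 := by
    refine le_antisymm ?_ (Finset.sum_nonneg fun k hk' => hnn k (Finset.mem_of_mem_erase hk'))
    rw [h2] at h1
    simpa using h1
  have h4 := (Finset.sum_eq_zero_iff_of_nonneg
    (fun k hk' => hnn k (Finset.mem_of_mem_erase hk'))).1 h3 i (Finset.mem_erase.2 ⟨hij, hi⟩)
  exact CStarRing.star_mul_self_eq_zero_iff _ |>.1 h4

lemma p_mul_S (e : E) : p G (G.src e) * S G e = S G e := by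
  classical
  have hsum := (family G).p_eq_sum (G.src e) ⟨e, rfl⟩
  have he : e ∈ (G.row_finite (G.src e)).toFinset := by simp
  have horth : ∀ f ∈ (G.row_finite (G.src e)).toFinset, f ≠ e →
      S G f * star (S G f) * S G e = 0 := by
    intro f hf hfe
    have := orth_of_sum (G.row_finite (G.src e)).toFinset (fun f => S G f * star (S G f))
      (fun f _ => isStarProjection_S_star G f) (hsum ▸ (family G).isStarProjection_p _) hf he hfe
    calc S G f * star (S G f) * S G e
        = S G f * star (S G f) * (S G e * star (S G e) * S G e) := by
          congr 1; exact ((family G).isPartialIsometry e).symm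
      _ = (S G f * star (S G f)) * (S G e * star (S G e)) * S G e := by simp only [mul_assoc]
      _ = 0 := by rw [this, zero_mul]
  have hsum' : p G (G.src e) = ∑ e ∈ (G.row_finite (G.src e)).toFinset, S G e * star (S G e) :=
    hsum
  rw [hsum', Finset.sum_mul, Finset.sum_eq_single e horth (fun h => absurd he h)]
  exact (family G).isPartialIsometry e

lemma star_S_mul_S_of_ne {e f : E} (h : e ≠ f) : star (S G e) * S G f = 0 := by
  classical
  have k : S G e * star (S G e) * (S G f * star (S G f)) = 0 := by
    by_cases hs : G.src e = G.src f
    · have hsum := (family G).p_eq_sum (G.src e) ⟨e, rfl⟩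
      exact orth_of_sum (G.row_finite (G.src e)).toFinset (fun f => S G f * star (S G f))
        (fun f _ => isStarProjection_S_star G f) (hsum ▸ (family G).isStarProjection_p _)
        (by simp) (by simp [hs]) h
    · have h1 : star (S G e) * S G f = 0 := by
        rw [← p_mul_S G e, ← p_mul_S G f, star_mul, p_star, mul_assoc, ← mul_assoc (p G _) (p G _),
          p_orth G hs, zero_mul, mul_zero]
      rw [mul_assoc, ← mul_assoc (star _), h1, zero_mul, mul_zero]
  have he : star (S G e) * S G e * star (S G e) = star (S G e) := by
    have := congrArg star ((family G).isPartialIsometry e)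
    simpa [mul_assoc] using! this
  have hf : S G f * star (S G f) * S G f = S G f := (family G).isPartialIsometry f
  calc star (S G e) * S G f
      = (star (S G e) * S G e * star (S G e)) * (S G f * star (S G f) * S G f) := by rw [he, hf]
    _ = star (S G e) * (S G e * star (S G e) * (S G f * star (S G f))) * S G f := by
        simp only [mul_assoc]
    _ = 0 := by rw [k, mul_zero, zero_mul]

lemma p_mul_word (v : V) (l : List E) (h : G.IsPathFrom v l) :
    p G v * word G v l = word G v l := by
  cases l with
  | nil => exact p_sq G v
  | cons e l =>
    obtain ⟨rfl, _⟩ := h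
    simp only [word]
    rw [← mul_assoc, p_mul_S]

lemma word_mul_p (v : V) (l : List E) : word G v l * p G (G.rangeFrom v l) = word G v l := by
  induction l generalizing v with
  | nil => exact p_sq G v
  | cons e l ih => simp only [word, rangeFrom, mul_assoc, ih]

lemma word_concat (v : V) (l : List E) (e : E) (h : G.IsPathFrom v l)
    (he : G.src e = G.rangeFrom v l) :
    G.IsPathFrom v (l ++ [e]) ∧ G.rangeFrom v (l ++ [e]) = G.rng e ∧
      word G v l * S G e = word G v (l ++ [e]) := by
  induction l generalizing v with
  | nil =>
    simp only [rangeFrom] at he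
    subst he
    exact ⟨⟨rfl, trivial⟩, rfl, by simp only [List.nil_append, word, p_mul_S, S_mul_p]⟩
  | cons f l ih =>
    obtain ⟨hf, hl⟩ := h
    obtain ⟨h1, h2, h3⟩ := ih (G.rng f) hl he
    exact ⟨⟨hf, h1⟩, h2, by simp only [List.cons_append, word, mul_assoc, h3]⟩

lemma path_mul_star_mem (μ ν : G.FinPath) : path G μ * star (path G ν) ∈ Ac G := by
  by_cases h : μ.range = ν.range
  · exact Submodule.subset_span ⟨μ, ν, h, rfl⟩
  · have h1 := word_mul_p G μ.source μ.edges
    have h2 := word_mul_p G ν.source ν.edges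
    have : path G μ * star (path G ν) = 0 := by
      rw [path, path, ← h1, ← h2, star_mul, p_star, mul_assoc, ← mul_assoc (p G _) (p G _)]
      rw [p_orth G (v := G.rangeFrom μ.source μ.edges) (w := G.rangeFrom ν.source ν.edges) h,
        zero_mul, mul_zero]
    rw [this]
    exact zero_mem _

lemma star_mem_Ac {a : G.CStar} (ha : a ∈ Ac G) : star a ∈ Ac G := by
  induction ha using Submodule.span_induction with
  | mem x hx =>
    obtain ⟨μ, ν, _, rfl⟩ := hx
    rw [star_mul, star_star]
    exact path_mul_star_mem G ν μ
  | zero => rw [star_zero]; exact zero_mem _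
  | add x y _ _ hx hy => rw [star_add]; exact add_mem hx hy
  | smul c x _ hx => rw [star_smul]; exact Submodule.smul_mem _ _ hx

/-- A right multiplication that preserves `A_c` on generators preserves `A_c`. -/
lemma mul_mem_Ac_of {b : G.CStar}
    (h : ∀ μ ν : G.FinPath, μ.range = ν.range → path G μ * star (path G ν) * b ∈ Ac G)
    {a : G.CStar} (ha : a ∈ Ac G) : a * b ∈ Ac G := by
  induction ha using Submodule.span_induction with
  | mem x hx => obtain ⟨μ, ν, hr, rfl⟩ := hx; exact h μ ν hr
  | zero => rw [zero_mul]; exact zero_mem _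
  | add x y _ _ hx hy => rw [add_mul]; exact add_mem hx hy
  | smul c x _ hx => rw [smul_mul_assoc]; exact Submodule.smul_mem _ _ hx

lemma mul_p_mem {a : G.CStar} (ha : a ∈ Ac G) (v : V) : a * p G v ∈ Ac G := by
  refine mul_mem_Ac_of G (fun μ ν _ => ?_) ha
  have h1 := p_mul_word G ν.source ν.edges ν.isPath
  by_cases h : ν.source = v
  · have : star (path G ν) * p G v = star (path G ν) := by
      rw [← p_star G v, ← star_mul, ← h]
      exact congrArg star h1
    rw [mul_assoc, this]
    exact path_mul_star_mem G μ ν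
  · have : star (path G ν) * p G v = 0 := by
      rw [path, ← h1, star_mul, p_star, mul_assoc, p_orth G h, mul_zero]
    rw [mul_assoc, this, mul_zero]
    exact zero_mem _

lemma mul_star_S_mem {a : G.CStar} (ha : a ∈ Ac G) (e : E) : a * star (S G e) ∈ Ac G := by
  refine mul_mem_Ac_of G (fun μ ν _ => ?_) ha
  rw [mul_assoc, ← star_mul]
  by_cases h : G.rng e = ν.source
  · have : S G e * path G ν =
        path G ⟨G.src e, e :: ν.edges, ⟨rfl, by rw [h]; exact ν.isPath⟩⟩ := by
      simp only [path, word, h]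
    rw [this]
    exact path_mul_star_mem G μ _
  · have : S G e * path G ν = 0 := by
      rw [path, ← p_mul_word G ν.source ν.edges ν.isPath, ← S_mul_p, mul_assoc,
        ← mul_assoc (p G _) (p G _), p_orth G h, zero_mul, mul_zero]
    rw [this, star_zero, mul_zero]
    exact zero_mem _

lemma mul_S_mem {a : G.CStar} (ha : a ∈ Ac G) (e : E) : a * S G e ∈ Ac G := by
  refine mul_mem_Ac_of G (fun μ ν hr => ?_) ha
  obtain ⟨w, l, hl⟩ := ν
  cases l with
  | nil =>
    have hr' : G.rangeFrom μ.source μ.edges = w := hr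
    have h0 : path G μ * star (path G ⟨w, [], hl⟩) = path G μ := by
      simp only [path, word, p_star]
      rw [← hr', word_mul_p]
    rw [h0]
    by_cases h : G.src e = w
    · obtain ⟨h1, h2, h3⟩ := word_concat G μ.source μ.edges e μ.isPath (h.trans hr'.symm)
      have : path G μ * S G e = path G ⟨_, _, h1⟩ * star (path G ⟨G.rng e, [], trivial⟩) := by
        simp only [path, word, p_star]
        rw [← h2, word_mul_p]
        exact h3
      rw [this]
      exact path_mul_star_mem G _ _
    · have : path G μ * S G e = 0 := by
        rw [path, ← word_mul_p, ← p_mul_S, mul_assoc, ← mul_assoc (p G _) (p G _),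
          p_orth G (fun h' => h (by rw [← hr', h'])), zero_mul, mul_zero]
      rw [this]
      exact zero_mem _
  | cons f l =>
    simp only [path, word, star_mul, mul_assoc]
    by_cases h : f = e
    · subst h
      rw [star_S_mul_S, ← mul_assoc]
      exact mul_p_mem G (path_mul_star_mem G μ ⟨G.rng f, l, hl.2⟩) _
    · rw [star_S_mul_S_of_ne G h, mul_zero, mul_zero]
      exact zero_mem _

lemma mul_word_mem (l : List E) (v : V) {a : G.CStar} (ha : a ∈ Ac G) :
    a * word G v l ∈ Ac G := by
  induction l generalizing v a with
  | nil => exact mul_p_mem G ha v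
  | cons e l ih =>
    simp only [word]
    rw [← mul_assoc]
    exact ih _ (mul_S_mem G ha e)

lemma mul_star_word_mem (l : List E) (v : V) {a : G.CStar} (ha : a ∈ Ac G) :
    a * star (word G v l) ∈ Ac G := by
  induction l generalizing v a with
  | nil => simp only [word, p_star]; exact mul_p_mem G ha v
  | cons e l ih =>
    simp only [word, star_mul]
    rw [← mul_assoc]
    exact mul_star_S_mem G (ih _ ha) e

lemma mul_mem_Ac {a b : G.CStar} (ha : a ∈ Ac G) (hb : b ∈ Ac G) : a * b ∈ Ac G := by
  induction hb using Submodule.span_induction with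
  | mem x hx =>
    obtain ⟨μ, ν, _, rfl⟩ := hx
    rw [← mul_assoc]
    exact mul_star_word_mem G _ _ (mul_word_mem G _ _ ha)
  | zero => rw [mul_zero]; exact zero_mem _
  | add x y _ _ hx hy => rw [mul_add]; exact add_mem hx hy
  | smul c x _ hx => rw [mul_smul_comm]; exact Submodule.smul_mem _ _ hx

lemma p_mem_Ac (v : V) : p G v ∈ Ac G := by
  have : p G v = path G ⟨v, [], trivial⟩ * star (path G ⟨v, [], trivial⟩) := by
    simp only [path, word, p_star, p_sq]
  rw [this]
  exact path_mul_star_mem G _ _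

lemma path_mem_Ac (μ : G.FinPath) : path G μ ∈ Ac G := by
  have : path G μ = path G μ * star (path G ⟨μ.range, [], trivial⟩) := by
    simp only [path, word, p_star]
    exact (word_mul_p G _ _).symm
  rw [this]
  exact path_mul_star_mem G _ _

/-! ### The expectation on `A_c` -/

lemma gauge_word (z : Circle) (v : V) (l : List E) :
    gauge G z (word G v l) = ((z : ℂ) ^ l.length) • word G v l := by
  induction l generalizing v with
  | nil => simp only [word, gauge_p, List.length_nil, pow_zero, one_smul]
  | cons e l ih =>
    simp only [word, map_mul, gauge_S, ih, List.length_cons, smul_mul_assoc, mul_smul_comm,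
      smul_smul, pow_succ]

lemma gauge_gen (z : Circle) (μ ν : G.FinPath) :
    gauge G z (path G μ * star (path G ν)) =
      ((z ^ ((μ.length : ℤ) - ν.length) : Circle) : ℂ) • (path G μ * star (path G ν)) := by
  rw [map_mul, map_star, path, path, gauge_word, gauge_word, star_smul, smul_mul_assoc,
    mul_smul_comm, smul_smul]
  congr 1
  rw [zpow_sub]
  simp only [FinPath.length, zpow_natCast, Circle.coe_mul, Circle.coe_inv_eq_conj, Circle.coe_pow,
    map_pow, Complex.star_def]

lemma coe_exp_zpow (k : ℤ) (θ : ℝ) :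
    (((Circle.exp θ) ^ k : Circle) : ℂ) = Complex.exp ((k * Complex.I) * θ) := by
  rw [Circle.coe_zpow, Circle.coe_exp, ← Complex.exp_int_mul]
  congr 1
  ring

lemma continuous_gauge_of_mem {a : G.CStar} (ha : a ∈ Ac G) :
    Continuous fun θ : ℝ => gauge G (Circle.exp θ) a := by
  induction ha using Submodule.span_induction with
  | mem x hx =>
    obtain ⟨μ, ν, _, rfl⟩ := hx
    simp only [gauge_gen]
    have h : Continuous fun θ : ℝ =>
        (((Circle.exp θ) ^ ((μ.length : ℤ) - ν.length) : Circle) : ℂ) := by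
      simp only [coe_exp_zpow]
      fun_prop
    exact h.smul (continuous_const (y := path G μ * star (path G ν)))
  | zero =>
    simp only [map_zero]
    exact continuous_const
  | add x y _ _ hx hy => simp only [map_add]; exact hx.add hy
  | smul c x _ hx => simp only [map_smul]; exact hx.const_smul c

lemma expect_add {a b : G.CStar} (ha : a ∈ Ac G) (hb : b ∈ Ac G) :
    expect G (a + b) = expect G a + expect G b := by
  simp only [expect, map_add]
  rw [intervalIntegral.integral_add
    ((continuous_gauge_of_mem G ha).intervalIntegrable _ _)
    ((continuous_gauge_of_mem G hb).intervalIntegrable _ _), smul_add]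

lemma expect_smul (c : ℂ) (a : G.CStar) : expect G (c • a) = c • expect G a := by
  simp only [expect, map_smul]
  rw [intervalIntegral.integral_smul, smul_comm]

lemma expect_zero : expect G 0 = 0 := by
  simp [expect]

lemma integral_exp_zpow (k : ℤ) (hk : k ≠ 0) :
    ∫ θ in (0 : ℝ)..(2 * Real.pi), (((Circle.exp θ) ^ k : Circle) : ℂ) = 0 := by
  have hc : (k : ℂ) * Complex.I ≠ 0 := mul_ne_zero (by exact_mod_cast hk) Complex.I_ne_zero
  simp only [coe_exp_zpow]
  rw [integral_exp_mul_complex hc]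
  have h1 : Complex.exp ((k : ℂ) * Complex.I * ((2 * Real.pi : ℝ) : ℂ)) = 1 := by
    rw [Complex.exp_eq_one_iff]
    exact ⟨k, by push_cast; ring⟩
  rw [h1]
  simp

lemma expect_gen (μ ν : G.FinPath) :
    expect G (path G μ * star (path G ν)) =
      if μ.length = ν.length then path G μ * star (path G ν) else 0 := by
  simp only [expect, gauge_gen]
  rw [intervalIntegral.integral_smul_const]
  split_ifs with h
  · rw [h]
    simp only [sub_self, zpow_zero, Circle.coe_one, intervalIntegral.integral_const, sub_zero]
    rw [smul_assoc, one_smul, smul_smul, inv_mul_cancel₀ (by positivity), one_smul]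
  · rw [integral_exp_zpow _ (by omega), zero_smul, smul_zero]

lemma expect_mem_Ac {a : G.CStar} (ha : a ∈ Ac G) : expect G a ∈ Ac G := by
  induction ha using Submodule.span_induction with
  | mem x hx =>
    obtain ⟨μ, ν, hr, rfl⟩ := hx
    rw [expect_gen]
    split_ifs
    · exact path_mul_star_mem G μ ν
    · exact zero_mem _
  | zero => rw [expect_zero]; exact zero_mem _
  | add x y hx' hy' hx hy => rw [expect_add G hx' hy']; exact add_mem hx hy
  | smul c x _ hx => rw [expect_smul]; exact Submodule.smul_mem _ _ hx

lemma expect_expect {a : G.CStar} (ha : a ∈ Ac G) : expect G (expect G a) = expect G a := by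
  induction ha using Submodule.span_induction with
  | mem x hx =>
    obtain ⟨μ, ν, hr, rfl⟩ := hx
    rw [expect_gen]
    split_ifs with h
    · rw [expect_gen, if_pos h]
    · exact expect_zero G
  | zero => rw [expect_zero, expect_zero]
  | add x y hx' hy' hx hy =>
    rw [expect_add G hx' hy', expect_add G (expect_mem_Ac G hx') (expect_mem_Ac G hy'), hx, hy]
  | smul c x _ hx => rw [expect_smul, expect_smul, hx]

end CStar
end RowFiniteGraph

namespace RowFiniteGraph

variable {V : Type u} {E : Type v}

/-! ### The Hilbert space -/

/-- A faithful, semifinite, norm lower-semicontinuous, gauge invariant trace on `C^*(G)`. -/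
structure GaugeTrace (G : RowFiniteGraph V E) where
  toFun : PosCone G.CStar → ℝ≥0∞
  isTrace : IsTrace toFun
  faithful : IsFaithfulWeight toFun
  semifinite : IsDenselyDefined toFun
  lowerSemicontinuous : LowerSemicontinuous toFun
  gauge_invariant : ∀ (z : Circle) (a b : PosCone G.CStar),
    (b : G.CStar) = CStar.gauge G z a → toFun b = toFun a

namespace GaugeTrace

variable {G : RowFiniteGraph V E} (τ : G.GaugeTrace)

/-- The linear extension of `τ` to its domain of definition. -/
def ext (a : G.CStar) : ℂ := weightExt τ.toFun a

open CStar IsTrace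

lemma sqFinite_word (v : V) (l : List E) : SqFinite τ.toFun (word G v l) := by
  induction l generalizing v with
  | nil => exact τ.isTrace.sqFinite_projection τ.semifinite ((family G).isStarProjection_p v)
  | cons e l ih => exact τ.isTrace.sqFinite_mul_left _ (ih _)

lemma sqFinite_Ac {a : G.CStar} (ha : a ∈ Ac G) : SqFinite τ.toFun a := by
  induction ha using Submodule.span_induction with
  | mem x hx =>
    obtain ⟨μ, ν, _, rfl⟩ := hx
    exact τ.isTrace.sqFinite_mul_right _ (τ.sqFinite_word _ _)
  | zero =>
    have := τ.isTrace.apply_zero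
    have h2 : (⟨star (0 : G.CStar) * 0, star_mul_self_nonneg _⟩ : PosCone G.CStar) =
      ⟨0, le_rfl⟩ := Subtype.ext (by simp)
    rw [SqFinite, h2, this]
    exact ENNReal.zero_lt_top
  | add x y _ _ hx hy => exact τ.isTrace.sqFinite_add hx hy
  | smul c x _ hx => exact τ.isTrace.sqFinite_smul c hx

lemma hasValue {a b : G.CStar} (ha : a ∈ Ac G) (hb : b ∈ Ac G) :
    HasWeightValue τ.toFun (star a * b) (τ.ext (star a * b)) := by
  obtain ⟨c, hc⟩ := τ.isTrace.exists_hasWeightValue (τ.sqFinite_Ac ha) (τ.sqFinite_Ac hb)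
  rw [ext, τ.isTrace.weightExt_eq hc]
  exact hc

lemma hasValue_self {a : G.CStar} (ha : a ∈ Ac G) :
    τ.ext (star a * a) = ((τ.toFun ⟨star a * a, star_mul_self_nonneg a⟩).toReal : ℂ) :=
  τ.isTrace.weightExt_eq (τ.isTrace.hasWeightValue_of_nonneg ⟨star a * a, star_mul_self_nonneg a⟩
    (τ.sqFinite_Ac ha))

/-- `X_c`, the copy of `A_c` that carries the inner product `⟨x, y⟩ = τ(x^* y)`. -/
def Xc (_ : G.GaugeTrace) : Type _ := Ac G

instance : AddCommGroup τ.Xc := inferInstanceAs (AddCommGroup (Ac G))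

instance : Module ℂ τ.Xc := inferInstanceAs (Module ℂ (Ac G))

/-- The inclusion of `X_c = A_c` in `C^*(G)`. -/
def val : τ.Xc →ₗ[ℂ] G.CStar := (Ac G).subtype

lemma val_mem (x : τ.Xc) : τ.val x ∈ Ac G := Subtype.property (p := fun a => a ∈ Ac G) x

lemma val_injective : Function.Injective τ.val := Subtype.val_injective

/-- An element of `A_c` as an element of `X_c`. -/
def ofAc (a : G.CStar) (ha : a ∈ Ac G) : τ.Xc := ⟨a, ha⟩

@[simp] lemma val_ofAc (a : G.CStar) (ha : a ∈ Ac G) : τ.val (τ.ofAc a ha) = a := rfl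

/-- The inner product `⟨x, y⟩ = τ(x^* y)` on `X_c`. -/
@[reducible] def innerCore : InnerProductSpace.Core ℂ τ.Xc where
  inner x y := τ.ext (star (τ.val x) * τ.val y)
  conj_inner_symm x y := by
    have h := hasWeightValue_star (τ.hasValue (τ.val_mem y) (τ.val_mem x))
    rw [star_mul, star_star] at h
    exact (τ.isTrace.weightExt_eq h).symm
  re_inner_nonneg x := by
    rw [τ.hasValue_self (τ.val_mem x)]
    exact ENNReal.toReal_nonneg
  add_left x y z := by
    refine τ.isTrace.weightExt_eq ?_
    rw [map_add, star_add, add_mul]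
    exact τ.isTrace.hasWeightValue_add (τ.hasValue (τ.val_mem x) (τ.val_mem z))
      (τ.hasValue (τ.val_mem y) (τ.val_mem z))
  smul_left x y r := by
    refine τ.isTrace.weightExt_eq ?_
    rw [map_smul, star_smul, smul_mul_assoc]
    exact τ.isTrace.hasWeightValue_smul _ (τ.hasValue (τ.val_mem x) (τ.val_mem y))
  definite x h := by
    rw [τ.hasValue_self (τ.val_mem x)] at h
    have h1 : (τ.toFun ⟨star (τ.val x) * τ.val x, star_mul_self_nonneg _⟩).toReal = 0 := by
      exact_mod_cast h
    rw [ENNReal.toReal_eq_zero_iff] at h1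
    have h2 := τ.faithful _ (h1.resolve_right (τ.sqFinite_Ac (τ.val_mem x)).ne)
    have h3 : τ.val x = 0 := (CStarRing.star_mul_self_eq_zero_iff _).1 h2
    exact τ.val_injective (h3.trans (map_zero _).symm)

instance : NormedAddCommGroup τ.Xc := τ.innerCore.toNormedAddCommGroup

instance : InnerProductSpace ℂ τ.Xc := InnerProductSpace.ofCore τ.innerCore.toCore

lemma inner_def (x y : τ.Xc) : inner ℂ x y = τ.ext (star (τ.val x) * τ.val y) := rfl

/-- The Hilbert space `L²(X, τ)`, the completion of `X_c`. -/
abbrev L2 : Type _ := UniformSpace.Completion τ.Xc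

/-! ### Rank one operators -/

/-- The linear map `Θ_{x,y} z = x (y|z)_R = x Φ(y^* z)` on `X_c`. -/
def thetaLin (x y : τ.Xc) : τ.Xc →ₗ[ℂ] τ.Xc where
  toFun z := τ.ofAc (τ.val x * expect G (star (τ.val y) * τ.val z))
    (mul_mem_Ac G (τ.val_mem x) (expect_mem_Ac G
      (mul_mem_Ac G (star_mem_Ac G (τ.val_mem y)) (τ.val_mem z))))
  map_add' z w := τ.val_injective (by
    have hm : ∀ z, star (τ.val y) * τ.val z ∈ Ac G :=
      fun z => mul_mem_Ac G (star_mem_Ac G (τ.val_mem y)) (τ.val_mem z)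
    simp only [val_ofAc, map_add, mul_add, expect_add G (hm z) (hm w)])
  map_smul' c z := τ.val_injective (by
    simp only [val_ofAc, map_smul, mul_smul_comm, expect_smul, RingHom.id_apply])

lemma ext_gauge {a : G.CStar} {c : ℂ} (h : HasWeightValue τ.toFun a c) (z : Circle) :
    HasWeightValue τ.toFun (gauge G z a) c := by
  obtain ⟨a₀, a₁, a₂, a₃, h0, h1, h2, h3, rfl, rfl⟩ := h
  have hp : ∀ b : PosCone G.CStar, 0 ≤ gauge G z b := fun b => map_nonneg _ b.2
  have hg : ∀ b : PosCone G.CStar, τ.toFun ⟨gauge G z b, hp b⟩ = τ.toFun b :=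
    fun b => τ.gauge_invariant z b _ rfl
  refine ⟨⟨_, hp a₀⟩, ⟨_, hp a₁⟩, ⟨_, hp a₂⟩, ⟨_, hp a₃⟩, ?_, ?_, ?_, ?_, ?_, ?_⟩
  · rwa [hg]
  · rwa [hg]
  · rwa [hg]
  · rwa [hg]
  · simp only [map_add, map_sub, map_smul]
  · rw [hg, hg, hg, hg]

lemma ext_eq_zero {a : G.CStar} {c : ℂ} (h : HasWeightValue τ.toFun a c) (k : ℤ) (hk : k ≠ 0)
    (ha : ∀ z : Circle, gauge G z a = ((z ^ k : Circle) : ℂ) • a) : c = 0 := by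
  have hk' : (k : ℝ) ≠ 0 := by exact_mod_cast hk
  have hz : (((Circle.exp (Real.pi / k)) ^ k : Circle) : ℂ) = -1 := by
    rw [Circle.coe_zpow, Circle.coe_exp, ← Complex.exp_int_mul, ← Complex.exp_pi_mul_I]
    congr 1
    push_cast
    have : (k : ℂ) ≠ 0 := by exact_mod_cast hk
    field_simp
  have h1 := τ.ext_gauge h (Circle.exp (Real.pi / k))
  rw [ha, hz] at h1
  have h2 := τ.isTrace.hasWeightValue_unique h1 (τ.isTrace.hasWeightValue_smul (-1) h)
  have : (2 : ℂ) * c = 0 := by linear_combination h2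
  simpa using this

/-- The expectation on `X_c`. -/
def expectXc : τ.Xc →ₗ[ℂ] τ.Xc where
  toFun z := τ.ofAc (expect G (τ.val z)) (expect_mem_Ac G (τ.val_mem z))
  map_add' z w := τ.val_injective (by
    simp only [val_ofAc, map_add, expect_add G (τ.val_mem z) (τ.val_mem w)])
  map_smul' c z := τ.val_injective (by
    simp only [val_ofAc, map_smul, expect_smul, RingHom.id_apply])

lemma Xc_induction {P : τ.Xc → Prop}
    (hgen : ∀ μ ν : G.FinPath, P (τ.ofAc _ (path_mul_star_mem G μ ν)))
    (h0 : P 0) (hadd : ∀ x y, P x → P y → P (x + y)) (hsmul : ∀ (c : ℂ) x, P x → P (c • x))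
    (x : τ.Xc) : P x := by
  have : ∀ a (ha : a ∈ Ac G), P (τ.ofAc a ha) := by
    intro a ha
    induction ha using Submodule.span_induction with
    | mem x hx =>
      obtain ⟨μ, ν, _, rfl⟩ := hx
      exact hgen μ ν
    | zero => exact h0
    | add x y hx' hy' hx hy => exact hadd _ _ hx hy
    | smul c x _ hx => exact hsmul c _ hx
  exact this (τ.val x) (τ.val_mem x)

lemma inner_expect (x y : τ.Xc) : inner ℂ (τ.expectXc x) y = inner ℂ x (τ.expectXc y) := by
  revert y
  refine τ.Xc_induction
    (P := fun x => ∀ y, inner ℂ (τ.expectXc x) y = inner ℂ x (τ.expectXc y)) ?_ ?_ ?_ ?_ x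
  · intro μ ν y
    refine τ.Xc_induction
      (P := fun y => inner ℂ (τ.expectXc (τ.ofAc _ (path_mul_star_mem G μ ν))) y =
        inner ℂ (τ.ofAc _ (path_mul_star_mem G μ ν)) (τ.expectXc y)) ?_ ?_ ?_ ?_ y
    · intro α β
      set x := τ.ofAc _ (path_mul_star_mem G μ ν)
      set y := τ.ofAc _ (path_mul_star_mem G α β)
      have hx : τ.expectXc x = if μ.length = ν.length then x else 0 := by
        refine τ.val_injective ((expect_gen G μ ν).trans ?_)
        split_ifs <;> simp [x]
      have hy : τ.expectXc y = if α.length = β.length then y else 0 := by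
        refine τ.val_injective ((expect_gen G α β).trans ?_)
        split_ifs <;> simp [y]
      have hxy : ((α.length : ℤ) - β.length) - ((μ.length : ℤ) - ν.length) ≠ 0 →
          inner ℂ x y = 0 := by
        intro hk
        refine τ.ext_eq_zero (τ.hasValue (τ.val_mem x) (τ.val_mem y)) _ hk fun z => ?_
        simp only [x, y, val_ofAc]
        rw [map_mul, map_star, gauge_gen, gauge_gen, star_smul, smul_mul_assoc, mul_smul_comm,
          smul_smul]
        congr 1
        rw [zpow_sub z ((α.length : ℤ) - β.length), Circle.coe_mul, Circle.coe_inv_eq_conj,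
          mul_comm]
        rfl
      rw [hx, hy]
      split_ifs with h1 h2 h2
      · rfl
      · rw [inner_zero_right]; exact hxy (by omega)
      · rw [inner_zero_left]; exact (hxy (by omega)).symm
      · rw [inner_zero_left, inner_zero_right]
    · simp
    · intro a b ha hb
      rw [map_add, inner_add_right, inner_add_right, ha, hb]
    · intro c a ha
      rw [map_smul, inner_smul_right, inner_smul_right, ha]
  · intro y; simp
  · intro a b ha hb y
    rw [map_add, inner_add_left, inner_add_left, ha, hb]
  · intro c a ha y
    rw [map_smul, inner_smul_left, inner_smul_left, ha]

lemma norm_expect_le (x : τ.Xc) : ‖τ.expectXc x‖ ≤ ‖x‖ := by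
  have h1 : τ.expectXc (τ.expectXc x) = τ.expectXc x :=
    τ.val_injective (expect_expect G (τ.val_mem x))
  have h2 : inner ℂ (τ.expectXc x) (τ.expectXc x) = inner ℂ x (τ.expectXc x) := by
    rw [τ.inner_expect, h1]
  have h3 : ‖τ.expectXc x‖ ^ 2 ≤ ‖x‖ * ‖τ.expectXc x‖ := by
    rw [← inner_self_eq_norm_sq (𝕜 := ℂ), h2]
    exact (RCLike.re_le_norm _).trans (norm_inner_le_norm _ _)
  by_contra hlt
  push Not at hlt
  nlinarith [norm_nonneg x, norm_nonneg (τ.expectXc x)]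

lemma norm_ofAc_mul_le (a : G.CStar) (ha : a ∈ Ac G) (x : τ.Xc) :
    ‖τ.ofAc (a * τ.val x) (mul_mem_Ac G ha (τ.val_mem x))‖ ≤ ‖a‖ * ‖x‖ := by
  have hn : ∀ y : τ.Xc, ‖y‖ ^ 2 =
      (τ.toFun ⟨star (τ.val y) * τ.val y, star_mul_self_nonneg _⟩).toReal := by
    intro y
    rw [← inner_self_eq_norm_sq (𝕜 := ℂ), inner_def, τ.hasValue_self (τ.val_mem y)]
    simp
  refine le_of_sq_le_sq ?_ (by positivity)
  rw [mul_pow, hn, hn]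
  have h := τ.isTrace.sq_mul_le a (τ.val x)
  have h2 := ENNReal.toReal_mono
    (ENNReal.mul_lt_top ENNReal.coe_lt_top (τ.sqFinite_Ac (τ.val_mem x))).ne h
  rw [ENNReal.toReal_mul] at h2
  simpa using h2

lemma norm_thetaLin_le (x y z : τ.Xc) :
    ‖τ.thetaLin x y z‖ ≤ ‖τ.val x‖ * ‖star (τ.val y)‖ * ‖z‖ := by
  have h1 := τ.norm_ofAc_mul_le _ (star_mem_Ac G (τ.val_mem y)) z
  have h2 := τ.norm_expect_le (τ.ofAc (star (τ.val y) * τ.val z)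
    (mul_mem_Ac G (star_mem_Ac G (τ.val_mem y)) (τ.val_mem z)))
  have h3 := τ.norm_ofAc_mul_le _ (τ.val_mem x) (τ.expectXc (τ.ofAc (star (τ.val y) * τ.val z)
    (mul_mem_Ac G (star_mem_Ac G (τ.val_mem y)) (τ.val_mem z))))
  calc _ ≤ _ := h3
    _ ≤ ‖τ.val x‖ * (‖star (τ.val y)‖ * ‖z‖) :=
      mul_le_mul_of_nonneg_left (h2.trans h1) (norm_nonneg _)
    _ = _ := (mul_assoc _ _ _).symm

/-- The bounded operator `Θ_{x,y}` on `L²(X, τ)`. -/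
def theta (x y : τ.Xc) : τ.L2 →L[ℂ] τ.L2 :=
  ((τ.thetaLin x y).mkContinuous (‖τ.val x‖ * ‖star (τ.val y)‖)
    (τ.norm_thetaLin_le x y)).completion

lemma theta_coe (x y z : τ.Xc) : τ.theta x y (z : τ.L2) = (τ.thetaLin x y z : τ.L2) := by
  simp [theta]

/-- `End^{00}_F(X_c)`, the finite rank endomorphisms of `X_c`, acting on `L²(X, τ)`: the linear span
of the operators `Θ_{x,y}`, `x, y ∈ X_c`. -/
def finiteRank : Submodule ℂ (τ.L2 →L[ℂ] τ.L2) :=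
  Submodule.span ℂ {T | ∃ x y : τ.Xc, T = τ.theta x y}

lemma inner_thetaLin (x y z w : τ.Xc) :
    inner ℂ (τ.thetaLin x y z) w = inner ℂ z (τ.thetaLin y x w) := by
  have hm : ∀ a b : τ.Xc, star (τ.val a) * τ.val b ∈ Ac G :=
    fun a b => mul_mem_Ac G (star_mem_Ac G (τ.val_mem a)) (τ.val_mem b)
  have key := τ.inner_expect (τ.ofAc _ (hm y z)) (τ.ofAc _ (hm x w))
  simp only [inner_def] at key ⊢
  simp only [thetaLin, expectXc, LinearMap.coe_mk, AddHom.coe_mk, val_ofAc, star_mul, star_star,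
    mul_assoc] at key ⊢
  exact key

lemma star_theta (x y : τ.Xc) : star (τ.theta x y) = τ.theta y x := by
  rw [ContinuousLinearMap.star_eq_adjoint]
  symm
  rw [ContinuousLinearMap.eq_adjoint_iff]
  intro a b
  induction a, b using UniformSpace.Completion.induction_on₂ with
  | hp => exact isClosed_eq (by fun_prop) (by fun_prop)
  | ih a b =>
    rw [theta_coe, theta_coe, UniformSpace.Completion.inner_coe, UniformSpace.Completion.inner_coe,
      inner_thetaLin]

lemma star_mem_finiteRank {T : τ.L2 →L[ℂ] τ.L2} (hT : T ∈ τ.finiteRank) :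
    star T ∈ τ.finiteRank := by
  induction hT using Submodule.span_induction with
  | mem T hT =>
    obtain ⟨x, y, rfl⟩ := hT
    exact Submodule.subset_span ⟨y, x, τ.star_theta x y⟩
  | zero => rw [star_zero]; exact zero_mem _
  | add x y _ _ hx hy => rw [star_add]; exact add_mem hx hy
  | smul c x _ hx => rw [star_smul]; exact Submodule.smul_mem _ _ hx

/-- The von Neumann algebra `N = (End^{00}_F(X_c))''`. -/
def vonNeumann : VonNeumannAlgebra τ.L2 where
  carrier := Set.centralizer (Set.centralizer (τ.finiteRank : Set (τ.L2 →L[ℂ] τ.L2)))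
  mul_mem' := Set.mul_mem_centralizer
  one_mem' := Set.one_mem_centralizer
  add_mem' := Set.add_mem_centralizer
  zero_mem' := Set.zero_mem_centralizer
  algebraMap_mem' r := by
    intro T _
    exact (Algebra.commutes r T).symm
  star_mem' {T} hT := by
    have hs : ∀ {U : τ.L2 →L[ℂ] τ.L2},
        U ∈ Set.centralizer (τ.finiteRank : Set (τ.L2 →L[ℂ] τ.L2)) →
        star U ∈ Set.centralizer (τ.finiteRank : Set (τ.L2 →L[ℂ] τ.L2)) := by
      intro U hU R hR
      have := congrArg star (hU (star R) (τ.star_mem_finiteRank hR))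
      simpa using this.symm
    intro U hU
    have := congrArg star (hT (star U) (hs hU))
    simpa using this.symm
  centralizer_centralizer' := by
    simp

/-! ### The functional on the von Neumann algebra -/

/-- The vector `S_μ` of `X_c`. -/
def pathVec (μ : G.FinPath) : τ.Xc := τ.ofAc (path G μ) (path_mem_Ac G μ)

/-- The vector `S_μ^*` of `X_c`. -/
def pathStarVec (μ : G.FinPath) : τ.Xc := τ.ofAc (star (path G μ)) (star_mem_Ac G (path_mem_Ac G μ))

/-- `ω_μ(T) = ⟨S_μ, T S_μ⟩ + |r(μ)|_{|μ|}⁻¹ ⟨S_μ^*, T S_μ^*⟩` for `|μ| ≠ 0`, and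
`ω_v(T) = ⟨p_v, T p_v⟩`. -/
def omega (μ : G.FinPath) (T : τ.L2 →L[ℂ] τ.L2) : ℂ :=
  if μ.length = 0 then inner ℂ (τ.pathVec μ : τ.L2) (T (τ.pathVec μ))
  else inner ℂ (τ.pathVec μ : τ.L2) (T (τ.pathVec μ)) +
    (1 / (G.numPaths μ.range μ.length : ℂ)) *
      inner ℂ (τ.pathStarVec μ : τ.L2) (T (τ.pathStarVec μ))

/-- `τ̃(T) = lim_L ∑_{μ ∈ L} ω_μ(T) ∈ [0, ∞]` for `T ∈ N₊`, the limit over the net of finite sets of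
paths. For `T ≥ 0` each `ω_μ(T)` is a nonnegative real number. -/
def tilde (T : PosCone τ.vonNeumann.toStarSubalgebra) : ℝ≥0∞ :=
  ∑' μ : G.FinPath, ENNReal.ofReal (τ.omega μ T.1.1).re

end GaugeTrace
end RowFiniteGraph

section VN

variable {H : Type*} [NormedAddCommGroup H] [InnerProductSpace ℂ H] [CompleteSpace H]

/-- `φ` is normal: it preserves least upper bounds of bounded increasing nets. -/
def IsNormalWeight (M : VonNeumannAlgebra H) (φ : PosCone M.toStarSubalgebra → ℝ≥0∞) : Prop :=
  ∀ (D : Set (PosCone M.toStarSubalgebra)) (T : PosCone M.toStarSubalgebra),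
    D.Nonempty → DirectedOn (· ≤ ·) D → IsLUB D T → φ T = ⨆ R ∈ D, φ R

/-- A trace `φ` on a von Neumann algebra is semifinite: below each nonzero `T ∈ M₊` there is a nonzero
`R ∈ M₊` with `φ(R) < ∞`. -/
def IsSemifiniteWeight (M : VonNeumannAlgebra H) (φ : PosCone M.toStarSubalgebra → ℝ≥0∞) : Prop :=
  ∀ T : PosCone M.toStarSubalgebra, T.1 ≠ 0 → ∃ R : PosCone M.toStarSubalgebra,
    R ≤ T ∧ R.1 ≠ 0 ∧ φ R < ⊤

end VN

end

/-
The vectors `S_μ` together with `|r(μ)|_{|μ|}^{-1/2} S_μ^*`, `|μ| ≠ 0`, form a frame `ξ` of `X_c`: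
`∑ᵢ Θ_{ξᵢ,ξᵢ} = 1`. On `S_α S_β^*` with `|β| ≤ |α|` a single `S_μ` contributes, with `μ` an initial
segment of `α`; for `|α| < |β|` the contributions are `|r(μ)|_{|μ|}⁻¹ S_α S_β^*`, one for each path
`μ` of length `|β| - |α|` ending where `α` starts. Moreover `τ̃(T) = ∑ᵢ ⟨ξᵢ, T ξᵢ⟩`.

Every `T ∈ N` commutes with right multiplication by `Φ(X_c)`, so its matrix coefficients satisfy
`Φ(x^* T y) = Φ(y^* T^* x)^*`. Applying Parseval's identity to both indices and exchanging the two
sums gives `∑ᵢ ‖T ξᵢ‖² = ∑ᵢ ‖T^* ξᵢ‖²`, the trace property. Keeping `x` fixed instead gives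
`τ̃(Θ_{x,x}) = ‖x‖²`, whence the formula for `τ̃(Θ_{x,y})` by polarization.
-/

section WeakLimits

open Filter Topology ComplexOrder

variable {H : Type*} [NormedAddCommGroup H] [InnerProductSpace ℂ H]

lemma monotone_re_inner_apply (x : H) :
    Monotone fun T : H →L[ℂ] H => (inner ℂ x (T x)).re := fun S T h => by
  have hST := ((ContinuousLinearMap.le_def S T).1 h).re_inner_nonneg_right x
  rw [sub_apply, inner_sub_right, map_sub] at hST
  exact sub_nonneg.1 hST

lemma re_inner_apply_nonneg {T : H →L[ℂ] H} (hT : 0 ≤ T) (x : H) :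
    0 ≤ (inner ℂ x (T x)).re := by
  simpa using monotone_re_inner_apply x hT

variable {ι : Type*}

lemma nonneg_of_tendsto_inner {l : Filter ι} [l.NeBot] {A : ι → H →L[ℂ] H} {S : H →L[ℂ] H}
    (hA : ∀ᶠ i in l, 0 ≤ A i)
    (hS : ∀ x y, Tendsto (fun i => inner ℂ (A i x) y) l (𝓝 (inner ℂ (S x) y))) : 0 ≤ S := by
  rw [ContinuousLinearMap.nonneg_iff_isPositive, ContinuousLinearMap.isPositive_iff_complex]
  intro x
  have h : 0 ≤ inner ℂ (S x) x := ge_of_tendsto (hS x x) <| hA.mono fun i hi =>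
    ((ContinuousLinearMap.nonneg_iff_isPositive _).1 hi).inner_nonneg_left x
  exact ⟨Complex.conj_eq_iff_re.1 (Complex.conj_eq_iff_im.2 (Complex.nonneg_iff.1 h).2.symm),
    (Complex.nonneg_iff.1 h).1⟩

lemma exists_tendsto_inner_of_monotone [Preorder ι] {A : ι → H →L[ℂ] H} {B : H →L[ℂ] H}
    (hA : Monotone A) (hA0 : ∀ i, 0 ≤ A i) (hB : ∀ i, A i ≤ B) (x y : H) :
    ∃ c, Tendsto (fun i => inner ℂ (A i x) y) atTop (𝓝 c) := by
  have hdiag (x : H) : ∃ c, Tendsto (fun i => inner ℂ (A i x) x) atTop (𝓝 c) := by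
    have hbdd : BddAbove (Set.range fun i => (inner ℂ x (A i x)).re) :=
      ⟨_, Set.forall_mem_range.2 fun i => monotone_re_inner_apply x (hB i)⟩
    refine ⟨_, ((Complex.continuous_ofReal.tendsto _).comp
      (tendsto_atTop_ciSup ((monotone_re_inner_apply x).comp hA) hbdd)).congr fun i => ?_⟩
    have hsymm := ((ContinuousLinearMap.nonneg_iff_isPositive _).1 (hA0 i)).isSymmetric
    exact (hsymm.coe_re_inner_self_apply x).trans (hsymm x x).symm
  obtain ⟨c₀, h₀⟩ := hdiag (y + x)
  obtain ⟨c₁, h₁⟩ := hdiag (y - x)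
  obtain ⟨c₂, h₂⟩ := hdiag (y + Complex.I • x)
  obtain ⟨c₃, h₃⟩ := hdiag (y - Complex.I • x)
  exact ⟨_, ((((h₀.sub h₁).add (h₂.const_mul Complex.I)).sub
    (h₃.const_mul Complex.I)).div_const 4).congr fun i =>
      (inner_map_polarization (A i : H →ₗ[ℂ] H) y x).symm⟩

variable [CompleteSpace H]

lemma exists_tendsto_inner_of_norm_le {l : Filter ι} [l.NeBot] {A : ι → H →L[ℂ] H} {C : ℝ}
    (hC : ∀ i, ‖A i‖ ≤ C) (hA : ∀ x y, ∃ c, Tendsto (fun i => inner ℂ (A i x) y) l (𝓝 c)) :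
    ∃ S : H →L[ℂ] H, ∀ x y, Tendsto (fun i => inner ℂ (A i x) y) l (𝓝 (inner ℂ (S x) y)) := by
  choose c hc using hA
  have hbound (x y : H) : ‖c x y‖ ≤ C * ‖x‖ * ‖y‖ :=
    le_of_tendsto (hc x y).norm <| Eventually.of_forall fun i =>
      (norm_inner_le_norm _ _).trans (by gcongr; exact (A i).le_of_opNorm_le (hC i) x)
  let F : H →ₗ⋆[ℂ] H →ₗ[ℂ] ℂ := LinearMap.mk₂'ₛₗ (starRingEnd ℂ) (RingHom.id ℂ) c
    (fun x x' y => tendsto_nhds_unique (hc _ _)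
      (((hc x y).add (hc x' y)).congr fun i => by rw [map_add, inner_add_left]))
    (fun r x y => tendsto_nhds_unique (hc _ _)
      (((hc x y).const_smul _).congr fun i => by rw [map_smul, inner_smul_left, smul_eq_mul]))
    (fun x y y' => tendsto_nhds_unique (hc _ _)
      (((hc x y).add (hc x y')).congr fun i => by rw [inner_add_right]))
    (fun r x y => tendsto_nhds_unique (hc _ _)
      (((hc x y).const_smul r).congr fun i => by rw [inner_smul_right, smul_eq_mul]))
  refine ⟨InnerProductSpace.continuousLinearMapOfBilin (F.mkContinuous₂ C hbound), fun x y => ?_⟩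
  rw [InnerProductSpace.continuousLinearMapOfBilin_apply]
  exact hc x y

lemma mem_vonNeumannAlgebra_of_tendsto_inner (M : VonNeumannAlgebra H) {l : Filter ι} [l.NeBot]
    {A : ι → H →L[ℂ] H} {S : H →L[ℂ] H} (hA : ∀ i, A i ∈ M)
    (hS : ∀ x y, Tendsto (fun i => inner ℂ (A i x) y) l (𝓝 (inner ℂ (S x) y))) : S ∈ M := by
  rw [← M.commutant_commutant, VonNeumannAlgebra.mem_commutant_iff]
  intro U hU
  rw [VonNeumannAlgebra.mem_commutant_iff] at hU
  refine ContinuousLinearMap.ext fun x => ext_inner_right ℂ fun y => ?_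
  have hUS : Tendsto (fun i => inner ℂ (U (A i x)) y) l (𝓝 (inner ℂ (U (S x)) y)) := by
    simpa only [ContinuousLinearMap.adjoint_inner_right] using hS x (U.adjoint y)
  have hSU : Tendsto (fun i => inner ℂ (U (A i x)) y) l (𝓝 (inner ℂ (S (U x)) y)) :=
    (hS (U x) y).congr fun i => congrArg (inner ℂ · y) (DFunLike.congr_fun (hU (A i) (hA i)) x)
  exact tendsto_nhds_unique hUS hSU

theorem tendsto_inner_of_isLUB (M : VonNeumannAlgebra H) [Preorder ι] [IsDirectedOrder ι]
    [Nonempty ι] {A : ι → PosCone M.toStarSubalgebra} {T : PosCone M.toStarSubalgebra}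
    (hA : Monotone A) (hT : IsLUB (Set.range A) T) (x y : H) :
    Tendsto (fun i => inner ℂ ((A i).1.1 x) y) atTop (𝓝 (inner ℂ (T.1.1 x) y)) := by
  have hA0 (i) : 0 ≤ (A i).1.1 := (A i).2
  have hAT (i) : (A i).1.1 ≤ T.1.1 := hT.1 ⟨i, rfl⟩
  obtain ⟨S, hS⟩ := exists_tendsto_inner_of_norm_le (l := atTop) (A := fun i => (A i).1.1)
    (fun i => CStarAlgebra.norm_le_norm_of_nonneg_of_le (hA0 i) (hAT i))
    (exists_tendsto_inner_of_monotone hA hA0 hAT)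
  have hSM : S ∈ M := mem_vonNeumannAlgebra_of_tendsto_inner M (fun i => (A i).1.2) hS
  have hS0 : 0 ≤ S := nonneg_of_tendsto_inner (Eventually.of_forall hA0) hS
  have hAS (i) : (A i).1.1 ≤ S := by
    refine sub_nonneg.1 (nonneg_of_tendsto_inner (l := atTop) (A := fun j => (A j).1.1 - (A i).1.1)
      ((eventually_ge_atTop i).mono fun j hij => sub_nonneg.2 (hA hij)) fun x y => ?_)
    simpa only [sub_apply, inner_sub_left] using (hS x y).sub_const _
  have hST : S ≤ T.1.1 := by
    refine sub_nonneg.1 (nonneg_of_tendsto_inner (l := atTop) (A := fun j => T.1.1 - (A j).1.1)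
      (Eventually.of_forall fun j => sub_nonneg.2 (hAT j)) fun x y => ?_)
    simpa only [sub_apply, inner_sub_left] using (hS x y).const_sub _
  have hTS : T ≤ ⟨⟨S, hSM⟩, hS0⟩ := hT.2 (Set.forall_mem_range.2 hAS)
  rw [show T.1.1 = S from le_antisymm hTS hST]
  exact hS x y

end WeakLimits

section ResolutionOfIdentity

open Filter

variable {H ι : Type*} [NormedAddCommGroup H] [InnerProductSpace ℂ H] [CompleteSpace H]
  {P : ι → H →L[ℂ] H} {s : Set H}

lemma sum_le_one_of_hasSum_apply (hP : ∀ i, 0 ≤ P i) (hs : Dense s)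
    (h : ∀ x ∈ s, HasSum (fun i => P i x) x) (F : Finset ι) : ∑ i ∈ F, P i ≤ 1 := by
  have hbessel (x : H) : (inner ℂ x ((∑ i ∈ F, P i) x)).re ≤ (inner ℂ x x).re := by
    refine hs.induction (P := fun x => (inner ℂ x ((∑ i ∈ F, P i) x)).re ≤ (inner ℂ x x).re)
      (fun x hx => ?_) (isClosed_le (by fun_prop) (by fun_prop)) x
    have hsum : HasSum (fun i => (inner ℂ x (P i x)).re) (inner ℂ x x).re :=
      Complex.hasSum_re ((h x hx).mapL (innerSL ℂ x))
    rw [sum_apply, inner_sum, Complex.re_sum]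
    exact sum_le_hasSum F (fun i _ => re_inner_apply_nonneg (hP i) x) hsum
  rw [ContinuousLinearMap.le_def, ContinuousLinearMap.isPositive_def']
  refine ⟨(IsSelfAdjoint.one _).sub (.of_nonneg (Finset.sum_nonneg fun i _ => hP i)), fun x => ?_⟩
  rw [ContinuousLinearMap.reApplyInnerSelf_apply, inner_re_symm, sub_apply, inner_sub_right,
    map_sub]
  exact sub_nonneg.2 (hbessel x)

lemma hasSum_apply_of_dense (hP : ∀ i, 0 ≤ P i) (hs : Dense s)
    (h : ∀ x ∈ s, HasSum (fun i => P i x) x) (x : H) : HasSum (fun i => P i x) x := by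
  have hnorm (F : Finset ι) : ‖∑ i ∈ F, P i‖ ≤ 1 :=
    (CStarAlgebra.norm_le_one_iff_of_nonneg _ (Finset.sum_nonneg fun i _ => hP i)).2
      (sum_le_one_of_hasSum_apply hP hs h F)
  have hequi : Equicontinuous fun (F : Finset ι) x => (∑ i ∈ F, P i) x :=
    ((NormedSpace.equicontinuous_TFAE fun F : Finset ι => ∑ i ∈ F, P i).out 5 1 :).1 ⟨1, hnorm⟩
  refine hs.induction (P := fun x => HasSum (fun i => P i x) x) h ?_ x
  simpa only [HasSum, SummationFilter.unconditional_filter, sum_apply, id] using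
    hequi.isClosed_setOfPred_tendsto (l := atTop) continuous_id

lemma ofReal_re_inner_star_mul_self (X : H →L[ℂ] H) (x : H) :
    ENNReal.ofReal (inner ℂ x ((star X * X) x)).re = ‖X x‖ₑ ^ 2 := by
  rw [ContinuousLinearMap.star_eq_adjoint, mul_apply_eq_comp,
    ContinuousLinearMap.adjoint_inner_right, ← ofReal_norm,
    ← ENNReal.ofReal_pow (norm_nonneg _), ← inner_self_eq_norm_sq (𝕜 := ℂ)]
  rfl

lemma tsum_enorm_sq_of_hasSum {C : ι → H →L[ℂ] H} {x : H}
    (h : HasSum (fun i => (star (C i) * C i) x) x) : ∑' i, ‖C i x‖ₑ ^ 2 = ‖x‖ₑ ^ 2 := by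
  have hre : HasSum (fun i => (inner ℂ x ((star (C i) * C i) x)).re) (inner ℂ x x).re :=
    Complex.hasSum_re (h.mapL (innerSL ℂ x))
  have hx := ofReal_re_inner_star_mul_self (1 : H →L[ℂ] H) x
  rw [star_one, one_mul, one_apply_eq_self] at hx
  rw [← hx, ← hre.tsum_eq, ENNReal.ofReal_tsum_of_nonneg
    (fun i => re_inner_apply_nonneg (star_mul_self_nonneg _) x) hre.summable]
  simp only [ofReal_re_inner_star_mul_self]

end ResolutionOfIdentity

section VonNeumannAlgebraOrder

variable {H : Type*} [NormedAddCommGroup H] [InnerProductSpace ℂ H] [CompleteSpace H]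
  (M : VonNeumannAlgebra H)

lemma isClosed_toStarSubalgebra : IsClosed (M.toStarSubalgebra : Set (H →L[ℂ] H)) := by
  rw [VonNeumannAlgebra.coe_toStarSubalgebra, ← M.centralizer_centralizer]
  exact Set.isClosed_centralizer _

variable {M} in
lemma sqrt_mem_toStarSubalgebra (T : PosCone M.toStarSubalgebra) :
    CFC.sqrt T.1.1 ∈ M.toStarSubalgebra := by
  have := isClosed_toStarSubalgebra M
  rw [CFC.sqrt_eq_real_sqrt T.1.1 T.2]
  exact cfcₙ_mem _ T.1.2

instance starOrderedRing_toStarSubalgebra : StarOrderedRing M.toStarSubalgebra :=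
  .of_nonneg_iff' (fun hxy z => add_le_add_right (α := H →L[ℂ] H) hxy z.1) fun T => by
    refine ⟨fun hT => ⟨⟨_, sqrt_mem_toStarSubalgebra ⟨T, hT⟩⟩, Subtype.ext ?_⟩, ?_⟩
    · exact ((congrArg (· * CFC.sqrt T.1) (CFC.sqrt_nonneg T.1).isSelfAdjoint.star_eq).trans
        (CFC.sqrt_mul_sqrt_self T.1 hT)).symm
    · rintro ⟨S, rfl⟩
      exact star_mul_self_nonneg S.1

end VonNeumannAlgebraOrder

section Weights

lemma mem_weightDomain_of_hasWeightValue {A : Type*} [NonUnitalRing A] [StarRing A] [Module ℂ A]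
    [PartialOrder A] {φ : PosCone A → ℝ≥0∞} {a : A} {c : ℂ} (h : HasWeightValue φ a c) :
    a ∈ weightDomain φ := by
  obtain ⟨a₀, a₁, a₂, a₃, h₀, h₁, h₂, h₃, rfl, -⟩ := h
  have hmem {b : PosCone A} (hb : φ b < ⊤) : (b : A) ∈ weightDomain φ :=
    Submodule.subset_span ⟨b.2, hb⟩
  exact add_mem (sub_mem (hmem h₀) (hmem h₁))
    (Submodule.smul_mem _ _ (sub_mem (hmem h₂) (hmem h₃)))

variable {A : Type*} [NonUnitalCStarAlgebra A] [PartialOrder A] [StarOrderedRing A]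
  {φ : PosCone A → ℝ≥0∞}

theorem IsTrace.hasWeightValue_of_sesquilinear (hφ : IsTrace φ) {X : Type*}
    [SeminormedAddCommGroup X] [InnerProductSpace ℂ X] {B : X →ₗ[ℂ] X →ₗ⋆[ℂ] A}
    (hB : ∀ x, 0 ≤ B x x) (hφB : ∀ x, φ ⟨B x x, hB x⟩ = ‖x‖ₑ ^ 2) (x y : X) :
    HasWeightValue φ (B x y) (inner ℂ y x) := by
  have hdiag (z : X) : HasWeightValue φ (B z z) (inner ℂ z z) := by
    have h := hφ.hasWeightValue_of_nonneg ⟨B z z, hB z⟩ (by simp [hφB])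
    rw [hφB, ENNReal.toReal_pow, toReal_enorm, Complex.ofReal_pow] at h
    rwa [inner_self_eq_norm_sq_to_K]
  have hpol := hφ.hasWeightValue_smul (1 / 4) (hφ.hasWeightValue_add
    (hφ.hasWeightValue_add (hdiag (x + y)) (hφ.hasWeightValue_smul (-1) (hdiag (x - y))))
    (hφ.hasWeightValue_smul Complex.I (hφ.hasWeightValue_add (hdiag (x + Complex.I • y))
      (hφ.hasWeightValue_smul (-1) (hdiag (x - Complex.I • y))))))
  convert hpol using 1
  · simp only [map_add, map_sub, map_smul, LinearMap.add_apply, LinearMap.sub_apply,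
      LinearMap.smul_apply, LinearMap.map_smulₛₗ, Complex.conj_I]
    match_scalars <;> ring_nf <;> simp only [Complex.I_sq] <;> ring_nf
  · simp only [inner_add_left, inner_add_right, inner_sub_left, inner_sub_right, inner_smul_left,
      inner_smul_right, Complex.conj_I]
    ring_nf
    simp only [Complex.I_sq]
    ring_nf

theorem IsTrace.isSemifiniteWeight {H κ : Type*} [NormedAddCommGroup H] [InnerProductSpace ℂ H]
    [CompleteSpace H] {M : VonNeumannAlgebra H} {φ : PosCone M.toStarSubalgebra → ℝ≥0∞}
    (hφ : IsTrace φ) (P : κ → PosCone M.toStarSubalgebra) (hP : ∀ j, φ (P j) < ⊤)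
    (hsep : ∀ S : M.toStarSubalgebra, (∀ j, S * (P j).1 = 0) → S = 0) :
    IsSemifiniteWeight M φ := by
  have := isClosed_toStarSubalgebra M
  intro T hT
  obtain ⟨s, hs⟩ := CStarAlgebra.nonneg_iff_eq_star_mul_self.1 T.2
  obtain ⟨j, hj⟩ : ∃ j, star s * (P j).1 ≠ 0 := by
    by_contra! h
    exact hT (by rw [hs, hsep _ h, zero_mul])
  obtain ⟨r, hr⟩ := CStarAlgebra.nonneg_iff_eq_star_mul_self.1 (P j).2
  have hrs : r * s ≠ 0 := fun h => hj <| by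
    rw [hr, ← mul_assoc, ← star_mul, h, star_zero, zero_mul]
  have hr0 : r ≠ 0 := left_ne_zero_of_mul hrs
  have hr_fin : SqFinite φ r := by simpa only [SqFinite, ← hr] using hP j
  set a : M.toStarSubalgebra := (‖r‖⁻¹ : ℂ) • r
  have ha : ‖a‖ = 1 := norm_smul_inv_norm hr0
  refine ⟨⟨star (a * s) * (a * s), star_mul_self_nonneg _⟩, ?_, ?_,
    hφ.sqFinite_mul_right s (hφ.sqFinite_smul _ hr_fin)⟩
  · simpa only [← Subtype.coe_le_coe, ha, one_pow, Complex.ofReal_one, one_smul, ← hs] using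
      star_mul_mul_le a s
  · rw [Ne, CStarRing.star_mul_self_eq_zero_iff, smul_mul_assoc]
    exact smul_ne_zero (inv_ne_zero (by exact_mod_cast norm_ne_zero_iff.2 hr0)) hrs

end Weights

section VectorWeight

lemma tsum_iSup_of_monotone {α ι : Type*} [Preorder ι] [IsDirectedOrder ι]
    {f : α → ι → ℝ≥0∞} (hf : ∀ a, Monotone (f a)) : ∑' a, ⨆ i, f a i = ⨆ i, ∑' a, f a i := by
  simp only [ENNReal.tsum_eq_iSup_sum]
  rw [iSup_comm]
  exact iSup_congr fun s => ENNReal.finsetSum_iSup_of_monotone hf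

variable {H ι : Type*} [NormedAddCommGroup H] [InnerProductSpace ℂ H] [CompleteSpace H]

/-- The weight `T ↦ ∑ᵢ ⟨ξᵢ, T ξᵢ⟩` on a von Neumann algebra. -/
noncomputable def vectorWeight (M : VonNeumannAlgebra H) (ξ : ι → H)
    (T : PosCone M.toStarSubalgebra) : ℝ≥0∞ :=
  ∑' i, ENNReal.ofReal (inner ℂ (ξ i) (T.1.1 (ξ i))).re

variable {M : VonNeumannAlgebra H} {ξ : ι → H}

lemma vectorWeight_of_eq_star_mul_self {T : PosCone M.toStarSubalgebra} {X : H →L[ℂ] H}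
    (h : T.1.1 = star X * X) : vectorWeight M ξ T = ∑' i, ‖X (ξ i)‖ₑ ^ 2 := by
  simp only [vectorWeight, h, ofReal_re_inner_star_mul_self]

theorem isTrace_vectorWeight
    (h : ∀ X ∈ M, ∑' i, ‖X (ξ i)‖ₑ ^ 2 = ∑' i, ‖star X (ξ i)‖ₑ ^ 2) :
    IsTrace (vectorWeight M ξ) where
  additive a b c hc := by
    simp only [vectorWeight, hc]
    rw [← ENNReal.tsum_add]
    refine tsum_congr fun i => ?_
    rw [← ENNReal.ofReal_add (re_inner_apply_nonneg a.2 _) (re_inner_apply_nonneg b.2 _),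
      ← Complex.add_re, ← inner_add_right]
    rfl
  homogeneous r a c hc := by
    simp only [vectorWeight, hc]
    rw [← ENNReal.tsum_mul_left]
    refine tsum_congr fun i => ?_
    rw [← ENNReal.ofReal_coe_nnreal, ← ENNReal.ofReal_mul r.coe_nonneg, ← Complex.re_ofReal_mul,
      ← inner_smul_right]
    rfl
  tracial x a b ha hb := by
    rw [vectorWeight_of_eq_star_mul_self (X := x.1) (congrArg Subtype.val ha),
      vectorWeight_of_eq_star_mul_self (X := star x.1) (by rw [hb, star_star]; rfl), h x.1 x.2]

theorem isFaithfulWeight_vectorWeight (h : ∀ X ∈ M, (∀ i, X (ξ i) = 0) → X = 0) :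
    IsFaithfulWeight (vectorWeight M ξ) := by
  have := isClosed_toStarSubalgebra M
  intro T hT
  obtain ⟨s, hs⟩ := CStarAlgebra.nonneg_iff_eq_star_mul_self.1 T.2
  rw [vectorWeight_of_eq_star_mul_self (X := s.1) (congrArg Subtype.val hs),
    ENNReal.tsum_eq_zero] at hT
  have hs0 : s = 0 := Subtype.ext <| h s.1 s.2 fun i => by simpa using hT i
  rw [hs, hs0, mul_zero]

theorem isNormalWeight_vectorWeight (M : VonNeumannAlgebra H) (ξ : ι → H) :
    IsNormalWeight M (vectorWeight M ξ) := by
  intro D T hD hdir hT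
  have := hD.to_subtype
  have : IsDirectedOrder D := ⟨hdir.directed_val⟩
  have hmono (x : H) :
      Monotone fun R : D => ENNReal.ofReal (inner ℂ x (R.1.1.1 x)).re :=
    fun R S hRS => ENNReal.ofReal_le_ofReal (monotone_re_inner_apply x hRS)
  have hsup (x : H) : ENNReal.ofReal (inner ℂ x (T.1.1 x)).re =
      ⨆ R : D, ENNReal.ofReal (inner ℂ x (R.1.1.1 x)).re := by
    refine tendsto_nhds_unique ?_ (tendsto_atTop_iSup (hmono x))
    have hlim := tendsto_inner_of_isLUB M (A := ((↑) : D → _)) (Subtype.mono_coe _)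
      (by rwa [Subtype.range_coe]) x x
    simpa only [Function.comp_def, ← inner_conj_symm x, Complex.conj_re] using
      ((ENNReal.continuous_ofReal.comp Complex.continuous_re).tendsto _).comp hlim
  simp only [vectorWeight, hsup]
  rw [tsum_iSup_of_monotone fun i => hmono (ξ i), iSup_subtype']

end VectorWeight

namespace RowFiniteGraph

variable {V : Type u} {E : Type v} {G : RowFiniteGraph V E}

/-! ### Paths -/

lemma isPathFrom_append {v : V} {l m : List E} :
    G.IsPathFrom v (l ++ m) ↔ G.IsPathFrom v l ∧ G.IsPathFrom (G.rangeFrom v l) m := by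
  induction l generalizing v with
  | nil => simp [IsPathFrom, rangeFrom]
  | cons e l ih => simp [IsPathFrom, rangeFrom, ih, and_assoc]

namespace FinPath

lemma ext {μ ν : G.FinPath} (hs : μ.source = ν.source) (he : μ.edges = ν.edges) :
    μ = ν := by
  cases μ; cases ν; simp_all

/-- The initial segment of length `k` of a path; the whole path if it is shorter than `k`. -/
def take (α : G.FinPath) (k : ℕ) : G.FinPath where
  source := α.source
  edges := α.edges.take k
  isPath := (isPathFrom_append.1 ((α.edges.take_append_drop k).symm ▸ α.isPath)).1

lemma length_take {α : G.FinPath} {k : ℕ} (h : k ≤ α.length) : (α.take k).length = k :=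
  List.length_take_of_le h

lemma isPathFrom_drop (α : G.FinPath) (k : ℕ) :
    G.IsPathFrom (α.take k).range (α.edges.drop k) :=
  (isPathFrom_append.1 ((α.edges.take_append_drop k).symm ▸ α.isPath)).2

end FinPath

lemma finite_paths_to (hfin : G.LocallyFinite) (v : V) (k : ℕ) :
    {μ : G.FinPath | μ.length = k ∧ μ.range = v}.Finite := by
  induction k with
  | zero =>
    refine (Set.finite_singleton (⟨v, [], trivial⟩ : G.FinPath)).subset ?_
    rintro ⟨w, l, hl⟩ ⟨hlen, hrange⟩
    obtain rfl : l = [] := List.length_eq_zero_iff.1 hlen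
    exact FinPath.ext hrange rfl
  | succ k ih =>
    have hcons := ih.biUnion fun ν _ => (hfin ν.source).image fun e => (G.src e, e :: ν.edges)
    refine Set.Finite.of_finite_image (f := fun μ : G.FinPath => (μ.source, μ.edges))
      (hcons.subset ?_) fun μ _ ν _ h => FinPath.ext (congrArg Prod.fst h) (congrArg Prod.snd h)
    rintro _ ⟨⟨w, _ | ⟨e, l⟩, hl⟩, ⟨hlen, hrange⟩, rfl⟩
    · simp [FinPath.length] at hlen
    · obtain ⟨rfl, hl⟩ := hl
      exact Set.mem_biUnion (x := (⟨G.rng e, l, hl⟩ : G.FinPath))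
        ⟨Nat.succ.inj hlen, hrange⟩ ⟨e, rfl, rfl⟩

lemma exists_path_to (hsrc : G.NoSources) (v : V) (k : ℕ) :
    ∃ μ : G.FinPath, μ.length = k ∧ μ.range = v := by
  induction k with
  | zero => exact ⟨⟨v, [], trivial⟩, rfl, rfl⟩
  | succ k ih =>
    obtain ⟨ν, hlen, hrange⟩ := ih
    obtain ⟨e, he⟩ := hsrc ν.source
    exact ⟨⟨G.src e, e :: ν.edges, rfl, he.symm ▸ ν.isPath⟩, congrArg Nat.succ hlen,
      (congrArg (G.rangeFrom · ν.edges) he).trans hrange⟩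

lemma numPaths_eq_card (hfin : G.LocallyFinite) (v : V) (k : ℕ) :
    G.numPaths v k = (finite_paths_to hfin v k).toFinset.card :=
  Set.ncard_eq_toFinset_card _ (finite_paths_to hfin v k)

lemma numPaths_ne_zero (hfin : G.LocallyFinite) (hsrc : G.NoSources) (v : V) (k : ℕ) :
    G.numPaths v k ≠ 0 := by
  obtain ⟨μ, hμ⟩ := exists_path_to hsrc v k
  rw [numPaths_eq_card hfin]
  exact Finset.card_ne_zero_of_mem ((Set.Finite.mem_toFinset _).2 hμ)

end RowFiniteGraph

namespace RowFiniteGraph.CStar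

variable {V : Type u} {E : Type v} {G : RowFiniteGraph V E}

/-! ### Spectral subspaces of the gauge action -/

/-- `a` lies in the spectral subspace of degree `k` of the gauge action: `γ_z(a) = z ^ k a`. -/
def IsHomogeneous (k : ℤ) (a : G.CStar) : Prop :=
  ∀ z : Circle, gauge G z a = ((z ^ k : Circle) : ℂ) • a

namespace IsHomogeneous

variable {k m : ℤ} {a b : G.CStar}

lemma zero (k : ℤ) : IsHomogeneous k (0 : G.CStar) := fun z => by rw [map_zero, smul_zero]

lemma add (ha : IsHomogeneous k a) (hb : IsHomogeneous k b) : IsHomogeneous k (a + b) := fun z => by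
  rw [map_add, ha z, hb z, smul_add]

lemma smul (c : ℂ) (ha : IsHomogeneous k a) : IsHomogeneous k (c • a) := fun z => by
  rw [map_smul, ha z, smul_comm]

lemma mul (ha : IsHomogeneous k a) (hb : IsHomogeneous m b) :
    IsHomogeneous (k + m) (a * b) := fun z => by
  rw [map_mul, ha z, hb z, zpow_add, Circle.coe_mul, smul_mul_assoc, mul_smul_comm, smul_smul]

protected lemma star (ha : IsHomogeneous k a) : IsHomogeneous (-k) (star a) := fun z => by
  rw [map_star, ha z, star_smul, zpow_neg, Circle.coe_inv_eq_conj, starRingEnd_apply]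

lemma expect_eq_self (ha : IsHomogeneous 0 a) : expect G a = a := by
  simp only [expect, ha _, zpow_zero, Circle.coe_one, one_smul, intervalIntegral.integral_const,
    sub_zero]
  exact inv_smul_smul₀ (by positivity) a

lemma expect_eq_zero (ha : IsHomogeneous k a) (hk : k ≠ 0) : expect G a = 0 := by
  simp only [expect, ha _]
  rw [intervalIntegral.integral_smul_const, integral_exp_zpow _ hk, zero_smul, smul_zero]

end IsHomogeneous

lemma isHomogeneous_path (μ : G.FinPath) : IsHomogeneous μ.length (path G μ) := fun z => by
  rw [path, gauge_word, zpow_natCast, Circle.coe_pow]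
  rfl

lemma isHomogeneous_path_mul_star (μ ν : G.FinPath) :
    IsHomogeneous ((μ.length : ℤ) - ν.length) (path G μ * star (path G ν)) :=
  (isHomogeneous_path μ).mul (isHomogeneous_path ν).star

lemma isHomogeneous_expect {a : G.CStar} (ha : a ∈ Ac G) : IsHomogeneous 0 (expect G a) := by
  induction ha using Submodule.span_induction with
  | mem x hx =>
    obtain ⟨μ, ν, _, rfl⟩ := hx
    have hx := isHomogeneous_path_mul_star μ ν
    by_cases h : (μ.length : ℤ) - ν.length = 0
    · rw [h] at hx
      rwa [hx.expect_eq_self]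
    · rw [hx.expect_eq_zero h]
      exact .zero 0
  | zero => rw [expect_zero]; exact .zero 0
  | add x y hx' hy' hx hy => rw [expect_add G hx' hy']; exact hx.add hy
  | smul c x _ hx => rw [expect_smul]; exact hx.smul c

lemma expect_map_of_gauge_equivariant {a : G.CStar} (ha : a ∈ Ac G) {L : G.CStar →L[ℝ] G.CStar}
    (hL : ∀ z, gauge G z (L a) = L (gauge G z a)) : expect G (L a) = L (expect G a) := by
  simp only [expect, hL, map_smul]
  rw [L.intervalIntegral_comp_comm ((continuous_gauge_of_mem G ha).intervalIntegrable _ _)]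

lemma expect_star {a : G.CStar} (ha : a ∈ Ac G) : expect G (star a) = star (expect G a) :=
  expect_map_of_gauge_equivariant (L := (starL' ℝ : G.CStar ≃L[ℝ] G.CStar)) ha
    fun z => map_star (gauge G z) a

lemma expect_mul_of_isHomogeneous_zero {a b : G.CStar} (ha : a ∈ Ac G) (hb : IsHomogeneous 0 b) :
    expect G (a * b) = expect G a * b :=
  expect_map_of_gauge_equivariant (L := (ContinuousLinearMap.mul ℝ G.CStar).flip b) ha fun z => by
    simp [hb z]

/-! ### Products of paths -/

lemma star_word_mul_word {v : V} {l : List E} (h : G.IsPathFrom v l) :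
    star (word G v l) * word G v l = p G (G.rangeFrom v l) := by
  induction l generalizing v with
  | nil => simp only [word, rangeFrom, p_star, p_sq]
  | cons e l ih =>
    simp only [word, rangeFrom, star_mul]
    rw [mul_assoc, ← mul_assoc (star (S G e)), star_S_mul_S, p_mul_word G _ _ h.2, ih h.2]

lemma star_word_mul_word_of_ne {v w : V} {l m : List E} (hl : G.IsPathFrom v l)
    (hm : G.IsPathFrom w m) (hlen : l.length = m.length) (hne : v = w → l ≠ m) :
    star (word G v l) * word G w m = 0 := by
  induction l generalizing v w m with
  | nil =>
    obtain rfl : m = [] := List.length_eq_zero_iff.1 hlen.symm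
    simp only [word, p_star]
    exact p_orth G fun h => hne h rfl
  | cons e l ih =>
    obtain _ | ⟨f, m⟩ := m
    · simp at hlen
    simp only [word, star_mul]
    rw [mul_assoc, ← mul_assoc (star (S G e))]
    rcases eq_or_ne e f with rfl | hef
    · rw [star_S_mul_S, p_mul_word G _ _ hm.2]
      exact ih hl.2 hm.2 (Nat.succ.inj hlen) fun _ hlm => hne (hl.1.symm.trans hm.1) (by rw [hlm])
    · rw [star_S_mul_S_of_ne G hef, zero_mul, mul_zero]

lemma word_append {v : V} {l m : List E} (h : G.IsPathFrom (G.rangeFrom v l) m) :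
    word G v (l ++ m) = word G v l * word G (G.rangeFrom v l) m := by
  induction l generalizing v with
  | nil => exact (p_mul_word G _ _ h).symm
  | cons e l ih =>
    simp only [List.cons_append, word, rangeFrom, mul_assoc]
    rw [ih h]

lemma star_path_mul_path (μ : G.FinPath) : star (path G μ) * path G μ = p G μ.range :=
  star_word_mul_word μ.isPath

lemma star_path_mul_path_of_ne {μ ν : G.FinPath} (hlen : μ.length = ν.length) (hne : μ ≠ ν) :
    star (path G μ) * path G ν = 0 :=
  star_word_mul_word_of_ne μ.isPath ν.isPath hlen fun hs he => hne (FinPath.ext hs he)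

lemma path_eq_take_mul (α : G.FinPath) (k : ℕ) :
    path G α = path G (α.take k) * word G (α.take k).range (α.edges.drop k) :=
  (congrArg (word G α.source) (α.edges.take_append_drop k)).symm.trans
    (word_append (α.isPathFrom_drop k))

lemma path_take_mul_star_mul (α : G.FinPath) (k : ℕ) :
    path G (α.take k) * (star (path G (α.take k)) * path G α) = path G α := by
  rw [path_eq_take_mul α k, ← mul_assoc (star _), star_path_mul_path,
    p_mul_word G _ _ (α.isPathFrom_drop k)]

lemma star_path_mul_path_of_ne_take {μ α : G.FinPath} (hlen : μ.length ≤ α.length)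
    (hne : μ ≠ α.take μ.length) : star (path G μ) * path G α = 0 := by
  rw [path_eq_take_mul α μ.length, ← mul_assoc,
    star_path_mul_path_of_ne (FinPath.length_take hlen).symm hne, zero_mul]

lemma p_source_mul_path (α : G.FinPath) : p G α.source * path G α = path G α :=
  p_mul_word G α.source α.edges α.isPath

lemma p_mul_path_of_ne {v : V} {α : G.FinPath} (h : v ≠ α.source) : p G v * path G α = 0 := by
  rw [← p_source_mul_path, ← mul_assoc, p_orth G h, zero_mul]

end RowFiniteGraph.CStar

namespace RowFiniteGraph.GaugeTrace

open CStar UniformSpace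

variable {V : Type u} {E : Type v} {G : RowFiniteGraph V E} (τ : G.GaugeTrace)

/-! ### The Hilbert algebra `X_c` -/

/-- The multiplication of `X_c`. -/
noncomputable def mulXc : τ.Xc →ₗ[ℂ] τ.Xc →ₗ[ℂ] τ.Xc :=
  LinearMap.mk₂ ℂ (fun x y => τ.ofAc (τ.val x * τ.val y) (mul_mem_Ac G (τ.val_mem x) (τ.val_mem y)))
    (fun x y z => τ.val_injective (by simp [add_mul]))
    (fun c x y => τ.val_injective (by simp [smul_mul_assoc]))
    (fun x y z => τ.val_injective (by simp [mul_add]))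
    (fun c x y => τ.val_injective (by simp [mul_smul_comm]))

/-- The involution of `X_c`. -/
noncomputable def starXc : τ.Xc →ₗ⋆[ℂ] τ.Xc where
  toFun x := τ.ofAc (star (τ.val x)) (star_mem_Ac G (τ.val_mem x))
  map_add' x y := τ.val_injective (by simp)
  map_smul' c x := τ.val_injective (by simp)

@[simp] lemma val_mulXc (x y : τ.Xc) : τ.val (τ.mulXc x y) = τ.val x * τ.val y := rfl

@[simp] lemma val_starXc (x : τ.Xc) : τ.val (τ.starXc x) = star (τ.val x) := rfl

lemma starXc_starXc (x : τ.Xc) : τ.starXc (τ.starXc x) = x := τ.val_injective (star_star _)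

lemma expectXc_starXc (x : τ.Xc) : τ.expectXc (τ.starXc x) = τ.starXc (τ.expectXc x) :=
  τ.val_injective (expect_star (τ.val_mem x))

lemma expectXc_expectXc (x : τ.Xc) : τ.expectXc (τ.expectXc x) = τ.expectXc x :=
  τ.val_injective (expect_expect G (τ.val_mem x))

lemma expectXc_mulXc_expectXc (x y : τ.Xc) :
    τ.expectXc (τ.mulXc x (τ.expectXc y)) = τ.mulXc (τ.expectXc x) (τ.expectXc y) :=
  τ.val_injective
    (expect_mul_of_isHomogeneous_zero (τ.val_mem x) (isHomogeneous_expect (τ.val_mem y)))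

lemma thetaLin_eq (x y z : τ.Xc) :
    τ.thetaLin x y z = τ.mulXc x (τ.expectXc (τ.mulXc (τ.starXc y) z)) := rfl

lemma toFun_star_mul_self (x : τ.Xc) :
    τ.toFun ⟨star (τ.val x) * τ.val x, star_mul_self_nonneg _⟩ = ‖x‖ₑ ^ 2 := by
  have h := inner_self_eq_norm_sq_to_K (𝕜 := ℂ) x
  rw [inner_def, τ.hasValue_self (τ.val_mem x)] at h
  rw [← ENNReal.ofReal_toReal (τ.sqFinite_Ac (τ.val_mem x)).ne, ← ofReal_norm,
    ← ENNReal.ofReal_pow (norm_nonneg x)]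
  exact congrArg ENNReal.ofReal (Complex.ofReal_injective (h.trans (Complex.ofReal_pow _ _).symm))

/-- The sesquilinear map `(x, y) ↦ x y^*`. -/
noncomputable def mulStar : τ.Xc →ₗ[ℂ] τ.Xc →ₗ⋆[ℂ] G.CStar :=
  LinearMap.mk₂'ₛₗ (RingHom.id ℂ) (starRingEnd ℂ) (fun x y => τ.val x * star (τ.val y))
    (by simp [add_mul]) (by simp [smul_mul_assoc]) (by simp [mul_add]) (by simp [mul_smul_comm])

lemma inner_starXc (x y : τ.Xc) : inner ℂ (τ.starXc x) (τ.starXc y) = inner ℂ y x := by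
  have h := τ.isTrace.hasWeightValue_of_sesquilinear (B := τ.mulStar)
    (fun x => mul_star_self_nonneg (τ.val x))
    (fun x => (τ.isTrace.tracial (τ.val x) _ _ rfl rfl).symm.trans (τ.toFun_star_mul_self x)) x y
  rw [inner_def, val_starXc, val_starXc, star_star]
  exact τ.isTrace.weightExt_eq h

lemma norm_starXc (x : τ.Xc) : ‖τ.starXc x‖ = ‖x‖ := by
  rw [@norm_eq_sqrt_re_inner ℂ, @norm_eq_sqrt_re_inner ℂ, inner_starXc]

lemma inner_mulXc_left (x y z : τ.Xc) :
    inner ℂ (τ.mulXc x y) z = inner ℂ y (τ.mulXc (τ.starXc x) z) := by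
  simp only [inner_def, val_mulXc, val_starXc, star_mul, mul_assoc]

lemma starXc_mulXc (x y : τ.Xc) :
    τ.starXc (τ.mulXc x y) = τ.mulXc (τ.starXc y) (τ.starXc x) :=
  τ.val_injective (star_mul _ _)

lemma inner_mulXc_right (x y z : τ.Xc) :
    inner ℂ (τ.mulXc x y) z = inner ℂ x (τ.mulXc z (τ.starXc y)) := by
  rw [← τ.inner_starXc z, ← τ.inner_starXc (τ.mulXc z _), starXc_mulXc, starXc_mulXc, starXc_starXc,
    inner_mulXc_left]

lemma norm_mulXc_le_left (x y : τ.Xc) : ‖τ.mulXc x y‖ ≤ ‖τ.val x‖ * ‖y‖ :=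
  τ.norm_ofAc_mul_le _ (τ.val_mem x) y

lemma norm_mulXc_le_right (x y : τ.Xc) : ‖τ.mulXc x y‖ ≤ ‖τ.val y‖ * ‖x‖ := by
  rw [← norm_starXc, starXc_mulXc, ← τ.norm_starXc x, ← norm_star (τ.val y)]
  exact τ.norm_mulXc_le_left _ _

/-! ### Matrix coefficients of operators on `L²(X, τ)` -/

/-- The extension of the involution of `X_c` to `L²(X, τ)`. -/
noncomputable def conj : τ.L2 →L⋆[ℂ] τ.L2 :=
  (τ.starXc.mkContinuous 1 fun x => by rw [norm_starXc, one_mul]).completion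

/-- Right multiplication by `y ∈ X_c` on `L²(X, τ)`. -/
noncomputable def rightMul (y : τ.Xc) : τ.L2 →L[ℂ] τ.L2 :=
  ((τ.mulXc.flip y).mkContinuous ‖τ.val y‖ fun x => τ.norm_mulXc_le_right x y).completion

/-- The operator `z ↦ Φ(x^* z)` on `L²(X, τ)`, the coefficient at `x` with respect to the
`F`-valued inner product of `X_c`. -/
noncomputable def coeff (x : τ.Xc) : τ.L2 →L[ℂ] τ.L2 :=
  ((τ.expectXc ∘ₗ τ.mulXc (τ.starXc x)).mkContinuous ‖star (τ.val x)‖ fun z =>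
    (τ.norm_expect_le _).trans (τ.norm_mulXc_le_left (τ.starXc x) z)).completion

lemma conj_coe (x : τ.Xc) : τ.conj (x : τ.L2) = (τ.starXc x : τ.L2) :=
  ContinuousLinearMap.completion_apply_coe _ x

lemma rightMul_coe (x y : τ.Xc) : τ.rightMul y (x : τ.L2) = (τ.mulXc x y : τ.L2) :=
  ContinuousLinearMap.completion_apply_coe _ x

lemma coeff_coe (x z : τ.Xc) :
    τ.coeff x (z : τ.L2) = (τ.expectXc (τ.mulXc (τ.starXc x) z) : τ.L2) :=
  ContinuousLinearMap.completion_apply_coe _ z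

lemma inner_conj_right (z : τ.Xc) (h : τ.L2) :
    inner ℂ (z : τ.L2) (τ.conj h) = inner ℂ h (τ.starXc z : τ.L2) := by
  induction h using Completion.induction_on with
  | hp => exact isClosed_eq (by fun_prop) (by fun_prop)
  | ih w => rw [conj_coe, Completion.inner_coe, Completion.inner_coe, ← inner_starXc, starXc_starXc]

lemma norm_conj (h : τ.L2) : ‖τ.conj h‖ = ‖h‖ := by
  induction h using Completion.induction_on with
  | hp => exact isClosed_eq (by fun_prop) (by fun_prop)
  | ih x => rw [conj_coe, Completion.norm_coe, Completion.norm_coe, norm_starXc]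

lemma inner_rightMul (x y : τ.Xc) (h : τ.L2) :
    inner ℂ (τ.rightMul y h) (x : τ.L2) = inner ℂ h (τ.mulXc x (τ.starXc y) : τ.L2) := by
  induction h using Completion.induction_on with
  | hp => exact isClosed_eq (by fun_prop) (by fun_prop)
  | ih z => rw [rightMul_coe, Completion.inner_coe, Completion.inner_coe, inner_mulXc_right]

lemma inner_coeff (x z : τ.Xc) (h : τ.L2) :
    inner ℂ (z : τ.L2) (τ.coeff x h) = inner ℂ (τ.mulXc x (τ.expectXc z) : τ.L2) h := by
  induction h using Completion.induction_on with
  | hp => exact isClosed_eq (by fun_prop) (by fun_prop)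
  | ih w =>
    rw [coeff_coe, Completion.inner_coe, Completion.inner_coe, ← inner_expect, inner_mulXc_left]

lemma ext_coe {T S : τ.L2 →L[ℂ] τ.L2} (h : ∀ x : τ.Xc, T x = S x) : T = S :=
  DFunLike.coe_injective (Completion.ext T.continuous S.continuous h)

lemma theta_mem (x y : τ.Xc) : τ.theta x y ∈ τ.vonNeumann := fun _ hU =>
  (hU _ (Submodule.subset_span ⟨x, y, rfl⟩)).symm

lemma theta_eq_star_coeff_mul (x y : τ.Xc) : τ.theta x y = star (τ.coeff x) * τ.coeff y := by
  refine τ.ext_coe fun w => ext_inner_left ℂ fun g => ?_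
  change _ = inner ℂ g (ContinuousLinearMap.adjoint (τ.coeff x) (τ.coeff y w))
  rw [ContinuousLinearMap.adjoint_inner_right]
  induction g using Completion.induction_on with
  | hp => exact isClosed_eq (by fun_prop) (by fun_prop)
  | ih z =>
    rw [theta_coe, coeff_coe, coeff_coe, Completion.inner_coe, Completion.inner_coe, thetaLin_eq,
      inner_expect, expectXc_expectXc, inner_mulXc_left, starXc_starXc]

lemma rightMul_expectXc_mem_centralizer (w : τ.Xc) : τ.rightMul (τ.expectXc w) ∈
    Set.centralizer (τ.finiteRank : Set (τ.L2 →L[ℂ] τ.L2)) := by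
  intro T hT
  replace hT : T ∈ τ.finiteRank := hT
  induction hT using Submodule.span_induction with
  | mem T hT =>
    obtain ⟨x, y, rfl⟩ := hT
    refine τ.ext_coe fun z => ?_
    change τ.theta x y (τ.rightMul _ z) = τ.rightMul _ (τ.theta x y z)
    have hassoc : ∀ a b c, τ.mulXc (τ.mulXc a b) c = τ.mulXc a (τ.mulXc b c) := fun a b c =>
      τ.val_injective (mul_assoc _ _ _)
    rw [rightMul_coe, theta_coe, theta_coe, rightMul_coe, thetaLin_eq, thetaLin_eq, ← hassoc,
      expectXc_mulXc_expectXc, hassoc]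
  | zero => rw [zero_mul, mul_zero]
  | add x y _ _ hx hy => rw [add_mul, mul_add, hx, hy]
  | smul c x _ hx => rw [smul_mul_assoc, mul_smul_comm, hx]

lemma apply_rightMul_expectXc {T : τ.L2 →L[ℂ] τ.L2} (hT : T ∈ τ.vonNeumann) (w : τ.Xc) (h : τ.L2) :
    T (τ.rightMul (τ.expectXc w) h) = τ.rightMul (τ.expectXc w) (T h) :=
  (congrArg (· h) (hT _ (τ.rightMul_expectXc_mem_centralizer w))).symm

theorem coeff_apply_eq_conj {T : τ.L2 →L[ℂ] τ.L2} (hT : T ∈ τ.vonNeumann) (x y : τ.Xc) :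
    τ.coeff x (T y) = τ.conj (τ.coeff y (star T x)) := by
  refine ext_inner_left ℂ fun z => ?_
  induction z using Completion.induction_on with
  | hp => exact isClosed_eq (by fun_prop) (by fun_prop)
  | ih z =>
    rw [inner_coeff, ← rightMul_coe, ← ContinuousLinearMap.adjoint_inner_left,
      ← ContinuousLinearMap.star_eq_adjoint, τ.apply_rightMul_expectXc (star_mem hT),
      inner_rightMul, inner_conj_right, ← expectXc_starXc, ← inner_conj_symm, ← inner_coeff,
      inner_conj_symm]

end RowFiniteGraph.GaugeTrace

namespace RowFiniteGraph.GaugeTrace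

open CStar UniformSpace

variable {V : Type u} {E : Type v} {G : RowFiniteGraph V E} (τ : G.GaugeTrace) {ι : Type*}

/-! ### Frames of `X_c` -/

/-- A family `ξ` in `X_c` is a frame if `∑ᵢ Θ_{ξᵢ,ξᵢ} z = z` for `z ∈ X_c`, in the norm of
`L²(X, τ)`. -/
def IsFrame (ξ : ι → τ.Xc) : Prop :=
  ∀ z, HasSum (fun i => τ.thetaLin (ξ i) (ξ i) z) z

/-- The map `(x, y) ↦ Θ_{x,y}` into the von Neumann algebra `N`. -/
noncomputable def thetaVN : τ.Xc →ₗ[ℂ] τ.Xc →ₗ⋆[ℂ] τ.vonNeumann.toStarSubalgebra :=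
  LinearMap.mk₂'ₛₗ (RingHom.id ℂ) (starRingEnd ℂ) (fun x y => ⟨τ.theta x y, τ.theta_mem x y⟩)
    (fun x y z => Subtype.ext <| τ.ext_coe fun w => by
      simp [theta_coe, thetaLin_eq, ← Completion.coe_add])
    (fun c x y => Subtype.ext <| τ.ext_coe fun w => by
      simp [theta_coe, thetaLin_eq, ← Completion.coe_smul])
    (fun x y z => Subtype.ext <| τ.ext_coe fun w => by
      simp [theta_coe, thetaLin_eq, ← Completion.coe_add])
    (fun c x y => Subtype.ext <| τ.ext_coe fun w => by
      simp [theta_coe, thetaLin_eq, ← Completion.coe_smul])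

lemma theta_self_nonneg (x : τ.Xc) : 0 ≤ τ.theta x x := by
  rw [theta_eq_star_coeff_mul]
  exact star_mul_self_nonneg _

lemma thetaVN_self_nonneg (x : τ.Xc) : 0 ≤ τ.thetaVN x x := τ.theta_self_nonneg x

namespace IsFrame

variable {τ} {ξ : ι → τ.Xc}

lemma hasSum_theta (hξ : τ.IsFrame ξ) (h : τ.L2) : HasSum (fun i => τ.theta (ξ i) (ξ i) h) h := by
  refine hasSum_apply_of_dense (fun i => τ.theta_self_nonneg (ξ i)) Completion.denseRange_coe ?_ h
  rintro _ ⟨z, rfl⟩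
  simp only [theta_coe]
  exact (hξ z).map Completion.toCompl Completion.continuous_toCompl

lemma tsum_enorm_coeff_sq (hξ : τ.IsFrame ξ) (h : τ.L2) :
    ∑' i, ‖τ.coeff (ξ i) h‖ₑ ^ 2 = ‖h‖ₑ ^ 2 :=
  tsum_enorm_sq_of_hasSum (by simpa only [theta_eq_star_coeff_mul] using hξ.hasSum_theta h)

lemma tsum_enorm_coeff_apply_sq (hξ : τ.IsFrame ξ) {T : τ.L2 →L[ℂ] τ.L2} (hT : T ∈ τ.vonNeumann)
    (x : τ.Xc) : ∑' i, ‖τ.coeff x (T (ξ i))‖ₑ ^ 2 = ‖star T x‖ₑ ^ 2 := by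
  rw [← hξ.tsum_enorm_coeff_sq]
  refine tsum_congr fun i => ?_
  rw [τ.coeff_apply_eq_conj hT, ← ofReal_norm, norm_conj, ofReal_norm]

lemma tsum_enorm_apply_sq (hξ : τ.IsFrame ξ) {T : τ.L2 →L[ℂ] τ.L2} (hT : T ∈ τ.vonNeumann) :
    ∑' i, ‖T (ξ i)‖ₑ ^ 2 = ∑' i, ‖star T (ξ i)‖ₑ ^ 2 := by
  calc ∑' i, ‖T (ξ i)‖ₑ ^ 2
    _ = ∑' i, ∑' j, ‖τ.coeff (ξ j) (T (ξ i))‖ₑ ^ 2 := by simp only [hξ.tsum_enorm_coeff_sq]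
    _ = ∑' j, ∑' i, ‖τ.coeff (ξ j) (T (ξ i))‖ₑ ^ 2 := ENNReal.tsum_comm
    _ = ∑' j, ‖star T (ξ j)‖ₑ ^ 2 := by simp only [hξ.tsum_enorm_coeff_apply_sq hT]

lemma eq_zero_of_apply_eq_zero (hξ : τ.IsFrame ξ) {T : τ.L2 →L[ℂ] τ.L2} (hT : T ∈ τ.vonNeumann)
    (h : ∀ i, T (ξ i) = 0) : T = 0 := by
  refine star_eq_zero.1 (τ.ext_coe fun x => ?_)
  simpa [h] using (hξ.tsum_enorm_coeff_apply_sq hT x).symm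

theorem isTrace_vectorWeight (hξ : τ.IsFrame ξ) :
    IsTrace (vectorWeight τ.vonNeumann fun i => (ξ i : τ.L2)) :=
  _root_.isTrace_vectorWeight fun _ => hξ.tsum_enorm_apply_sq

theorem isFaithfulWeight_vectorWeight (hξ : τ.IsFrame ξ) :
    IsFaithfulWeight (vectorWeight τ.vonNeumann fun i => (ξ i : τ.L2)) :=
  _root_.isFaithfulWeight_vectorWeight fun _ => hξ.eq_zero_of_apply_eq_zero

lemma vectorWeight_thetaVN (hξ : τ.IsFrame ξ) (x : τ.Xc) :
    vectorWeight τ.vonNeumann (fun i => (ξ i : τ.L2)) ⟨τ.thetaVN x x, τ.thetaVN_self_nonneg x⟩ =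
      ‖x‖ₑ ^ 2 := by
  rw [vectorWeight_of_eq_star_mul_self (τ.theta_eq_star_coeff_mul x x)]
  have h := hξ.tsum_enorm_coeff_apply_sq (one_mem τ.vonNeumann) x
  simpa only [star_one, one_apply_eq_self, Completion.enorm_coe] using h

theorem hasWeightValue_thetaVN (hξ : τ.IsFrame ξ) (x y : τ.Xc) :
    HasWeightValue (vectorWeight τ.vonNeumann fun i => (ξ i : τ.L2)) (τ.thetaVN x y)
      (inner ℂ y x) :=
  have := isClosed_toStarSubalgebra τ.vonNeumann
  hξ.isTrace_vectorWeight.hasWeightValue_of_sesquilinear τ.thetaVN_self_nonneg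
    hξ.vectorWeight_thetaVN x y

theorem weightExt_thetaVN (hξ : τ.IsFrame ξ) (x y : τ.Xc) :
    weightExt (vectorWeight τ.vonNeumann fun i => (ξ i : τ.L2)) (τ.thetaVN x y) = inner ℂ y x :=
  have := isClosed_toStarSubalgebra τ.vonNeumann
  hξ.isTrace_vectorWeight.weightExt_eq (hξ.hasWeightValue_thetaVN x y)

theorem isSemifiniteWeight_vectorWeight (hξ : τ.IsFrame ξ) :
    IsSemifiniteWeight τ.vonNeumann (vectorWeight τ.vonNeumann fun i => (ξ i : τ.L2)) := by
  refine hξ.isTrace_vectorWeight.isSemifiniteWeight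
    (fun i => ⟨τ.thetaVN (ξ i) (ξ i), τ.thetaVN_self_nonneg (ξ i)⟩) (fun i => ?_) fun S hS => ?_
  · rw [hξ.vectorWeight_thetaVN]
    exact ENNReal.pow_lt_top enorm_lt_top
  · refine Subtype.ext (ContinuousLinearMap.ext fun h => ?_)
    refine ((hξ.hasSum_theta h).mapL S.1).unique ?_
    have hS' (i) : S.1 (τ.theta (ξ i) (ξ i) h) = 0 :=
      congrArg (fun T : τ.vonNeumann.toStarSubalgebra => T.1 h) (hS i)
    simp only [hS']
    exact hasSum_zero

lemma mem_weightDomain_of_mem_finiteRank (hξ : τ.IsFrame ξ) {T : τ.L2 →L[ℂ] τ.L2}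
    (hT : T ∈ τ.finiteRank) :
    ∃ hT' : T ∈ τ.vonNeumann.toStarSubalgebra, (⟨T, hT'⟩ : τ.vonNeumann.toStarSubalgebra) ∈
      weightDomain (vectorWeight τ.vonNeumann fun i => (ξ i : τ.L2)) := by
  suffices h : τ.finiteRank ≤ (weightDomain (vectorWeight τ.vonNeumann
      fun i => (ξ i : τ.L2))).map τ.vonNeumann.toStarSubalgebra.subtype.toLinearMap by
    obtain ⟨S, hS, rfl⟩ := h hT
    exact ⟨S.2, hS⟩
  refine Submodule.span_le.2 ?_
  rintro _ ⟨x, y, rfl⟩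
  exact ⟨τ.thetaVN x y, mem_weightDomain_of_hasWeightValue (hξ.hasWeightValue_thetaVN x y), rfl⟩

end IsFrame

end RowFiniteGraph.GaugeTrace

namespace RowFiniteGraph.GaugeTrace

open CStar UniformSpace

variable {V : Type u} {E : Type v} {G : RowFiniteGraph V E} (τ : G.GaugeTrace)

/-! ### The path frame -/

lemma val_thetaLin_of_isHomogeneous {x z : τ.Xc} {k : ℤ} (hx : IsHomogeneous k (τ.val x))
    (hz : IsHomogeneous k (τ.val z)) :
    τ.val (τ.thetaLin x x z) = τ.val x * (star (τ.val x) * τ.val z) := by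
  have h := hx.star.mul hz
  rw [neg_add_cancel] at h
  exact congrArg (τ.val x * ·) h.expect_eq_self

lemma thetaLin_eq_zero_of_isHomogeneous {x z : τ.Xc} {k m : ℤ} (hx : IsHomogeneous k (τ.val x))
    (hz : IsHomogeneous m (τ.val z)) (hkm : k ≠ m) : τ.thetaLin x x z = 0 := by
  refine τ.val_injective ((congrArg (τ.val x * ·) ?_).trans (mul_zero _))
  exact (hx.star.mul hz).expect_eq_zero (by lia)

/-- The vector `S_α S_β^*` of `X_c`. -/
noncomputable def pathMulStar (α β : G.FinPath) : τ.Xc := τ.ofAc _ (path_mul_star_mem G α β)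

/-- The vector `|r(μ)|_{|μ|}^{-1/2} S_μ^*` for `|μ| ≠ 0`. It is `0` for a vertex `v`, since `p_v^*`
is already the frame vector `S_v`. -/
noncomputable def normalizedPathStar (μ : G.FinPath) : τ.Xc :=
  if μ.length = 0 then 0 else (((√(G.numPaths μ.range μ.length))⁻¹ : ℝ) : ℂ) • τ.pathStarVec μ

/-- The frame of all `S_μ` and all `|r(μ)|_{|μ|}^{-1/2} S_μ^*`, `|μ| ≠ 0`. -/
noncomputable def pathFrame : G.FinPath ⊕ G.FinPath → τ.Xc :=
  Sum.elim τ.pathVec τ.normalizedPathStar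

section Generators

variable {α β μ : G.FinPath}

lemma isHomogeneous_pathMulStar :
    IsHomogeneous ((α.length : ℤ) - β.length) (τ.val (τ.pathMulStar α β)) :=
  isHomogeneous_path_mul_star α β

lemma thetaLin_pathVec_of_length_ne (h : μ.length + β.length ≠ α.length) :
    τ.thetaLin (τ.pathVec μ) (τ.pathVec μ) (τ.pathMulStar α β) = 0 :=
  τ.thetaLin_eq_zero_of_isHomogeneous (isHomogeneous_path μ) τ.isHomogeneous_pathMulStar (by lia)

lemma val_thetaLin_pathVec (h : μ.length + β.length = α.length) :
    τ.val (τ.thetaLin (τ.pathVec μ) (τ.pathVec μ) (τ.pathMulStar α β)) =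
      path G μ * (star (path G μ) * path G α) * star (path G β) := by
  have hz := τ.isHomogeneous_pathMulStar (α := α) (β := β)
  rw [show (α.length : ℤ) - β.length = μ.length by lia] at hz
  rw [τ.val_thetaLin_of_isHomogeneous (x := τ.pathVec μ) (isHomogeneous_path μ) hz]
  simp only [pathVec, pathMulStar, val_ofAc, mul_assoc]

lemma hasSum_thetaLin_pathVec (h : β.length ≤ α.length) :
    HasSum (fun μ => τ.thetaLin (τ.pathVec μ) (τ.pathVec μ) (τ.pathMulStar α β))
      (τ.pathMulStar α β) := by
  set k := α.length - β.length
  have hlen : (α.take k).length = k := FinPath.length_take (Nat.sub_le _ _)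
  have htake : τ.thetaLin (τ.pathVec (α.take k)) (τ.pathVec (α.take k)) (τ.pathMulStar α β) =
      τ.pathMulStar α β := by
    refine τ.val_injective ?_
    rw [τ.val_thetaLin_pathVec (by lia), path_take_mul_star_mul]
    rfl
  have hsum := hasSum_single (f := fun μ => τ.thetaLin (τ.pathVec μ) (τ.pathVec μ)
    (τ.pathMulStar α β)) (α.take k) fun μ hμ => ?_
  · rwa [htake] at hsum
  by_cases hμlen : μ.length + β.length = α.length
  · have hne : μ ≠ α.take μ.length := by rwa [show μ.length = k by lia]
    refine τ.val_injective ?_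
    rw [τ.val_thetaLin_pathVec hμlen, star_path_mul_path_of_ne_take (by lia) hne, mul_zero,
      zero_mul, map_zero]
  · exact τ.thetaLin_pathVec_of_length_ne hμlen

lemma thetaLin_pathStarVec_of_length_ne (h : α.length + μ.length ≠ β.length) :
    τ.thetaLin (τ.pathStarVec μ) (τ.pathStarVec μ) (τ.pathMulStar α β) = 0 :=
  τ.thetaLin_eq_zero_of_isHomogeneous (x := τ.pathStarVec μ) (isHomogeneous_path μ).star
    τ.isHomogeneous_pathMulStar (by lia)

lemma val_thetaLin_pathStarVec (h : α.length + μ.length = β.length) :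
    τ.val (τ.thetaLin (τ.pathStarVec μ) (τ.pathStarVec μ) (τ.pathMulStar α β)) =
      p G μ.range * (path G α * star (path G β)) := by
  have hz := τ.isHomogeneous_pathMulStar (α := α) (β := β)
  rw [show (α.length : ℤ) - β.length = -μ.length by lia] at hz
  rw [τ.val_thetaLin_of_isHomogeneous (x := τ.pathStarVec μ) (isHomogeneous_path μ).star hz,
    ← star_path_mul_path]
  simp only [pathStarVec, pathMulStar, val_ofAc, star_star, mul_assoc]

lemma thetaLin_pathStarVec (h : α.length + μ.length = β.length) (hμ : μ.range = α.source) :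
    τ.thetaLin (τ.pathStarVec μ) (τ.pathStarVec μ) (τ.pathMulStar α β) = τ.pathMulStar α β := by
  refine τ.val_injective ?_
  rw [τ.val_thetaLin_pathStarVec h, hμ, ← mul_assoc, p_source_mul_path]
  rfl

lemma thetaLin_pathStarVec_of_range_ne (hμ : μ.range ≠ α.source) :
    τ.thetaLin (τ.pathStarVec μ) (τ.pathStarVec μ) (τ.pathMulStar α β) = 0 := by
  by_cases h : α.length + μ.length = β.length
  · refine τ.val_injective ?_
    rw [τ.val_thetaLin_pathStarVec h, ← mul_assoc, p_mul_path_of_ne hμ, zero_mul, map_zero]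
  · exact τ.thetaLin_pathStarVec_of_length_ne h

end Generators

lemma thetaLin_normalizedPathStar {μ : G.FinPath} (hμ : μ.length ≠ 0) (z : τ.Xc) :
    τ.thetaLin (τ.normalizedPathStar μ) (τ.normalizedPathStar μ) z =
      (G.numPaths μ.range μ.length : ℂ)⁻¹ • τ.thetaLin (τ.pathStarVec μ) (τ.pathStarVec μ) z := by
  rw [normalizedPathStar, if_neg hμ]
  simp only [thetaLin_eq, map_smul, LinearMap.map_smulₛₗ, LinearMap.smul_apply, smul_smul]
  rw [Complex.conj_ofReal, ← Complex.ofReal_mul, ← mul_inv, Real.mul_self_sqrt (Nat.cast_nonneg _),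
    Complex.ofReal_inv, Complex.ofReal_natCast]

lemma thetaLin_normalizedPathStar_eq_zero {μ : G.FinPath} {z : τ.Xc}
    (h : μ.length ≠ 0 → τ.thetaLin (τ.pathStarVec μ) (τ.pathStarVec μ) z = 0) :
    τ.thetaLin (τ.normalizedPathStar μ) (τ.normalizedPathStar μ) z = 0 := by
  by_cases hμ : μ.length = 0
  · simp [normalizedPathStar, hμ, thetaLin_eq]
  · rw [τ.thetaLin_normalizedPathStar hμ, h hμ, smul_zero]

lemma hasSum_thetaLin_normalizedPathStar (hfin : G.LocallyFinite) (hsrc : G.NoSources)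
    {α β : G.FinPath} (h : α.length < β.length) :
    HasSum (fun μ => τ.thetaLin (τ.normalizedPathStar μ) (τ.normalizedPathStar μ)
      (τ.pathMulStar α β)) (τ.pathMulStar α β) := by
  set k := β.length - α.length
  set s := (finite_paths_to hfin α.source k).toFinset
  have mem_s (μ : G.FinPath) : μ ∈ s ↔ μ.length = k ∧ μ.range = α.source := by simp [s]
  have hsum : ∑ μ ∈ s, τ.thetaLin (τ.normalizedPathStar μ) (τ.normalizedPathStar μ)
      (τ.pathMulStar α β) = τ.pathMulStar α β := by
    calc
      _ = ∑ _ ∈ s, (G.numPaths α.source k : ℂ)⁻¹ • τ.pathMulStar α β := by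
        refine Finset.sum_congr rfl fun μ hμ => ?_
        obtain ⟨hlen, hrange⟩ := (mem_s μ).1 hμ
        rw [τ.thetaLin_normalizedPathStar (by lia), τ.thetaLin_pathStarVec (by lia) hrange, hlen,
          hrange]
      _ = τ.pathMulStar α β := by
        rw [Finset.sum_const, ← numPaths_eq_card hfin, ← Nat.cast_smul_eq_nsmul ℂ,
          smul_inv_smul₀ (Nat.cast_ne_zero.2 (numPaths_ne_zero hfin hsrc _ _))]
  have hout (μ : G.FinPath) (hμ : μ ∉ s) :
      τ.thetaLin (τ.normalizedPathStar μ) (τ.normalizedPathStar μ) (τ.pathMulStar α β) = 0 := by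
    refine τ.thetaLin_normalizedPathStar_eq_zero fun _ => ?_
    by_cases hlen : μ.length = k
    · exact τ.thetaLin_pathStarVec_of_range_ne fun hrange => hμ ((mem_s μ).2 ⟨hlen, hrange⟩)
    · exact τ.thetaLin_pathStarVec_of_length_ne (by lia)
  have hasSum := hasSum_sum_of_ne_finset_zero (L := .unconditional _) hout
  rwa [hsum] at hasSum

lemma hasSum_thetaLin_pathFrame (hfin : G.LocallyFinite) (hsrc : G.NoSources) (α β : G.FinPath) :
    HasSum (fun i => τ.thetaLin (τ.pathFrame i) (τ.pathFrame i) (τ.pathMulStar α β))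
      (τ.pathMulStar α β) := by
  set z := τ.pathMulStar α β
  have hasSum_pathFrame {a b : τ.Xc}
      (ha : HasSum (fun μ => τ.thetaLin (τ.pathVec μ) (τ.pathVec μ) z) a)
      (hb : HasSum (fun μ => τ.thetaLin (τ.normalizedPathStar μ) (τ.normalizedPathStar μ) z) b) :
      HasSum (fun i => τ.thetaLin (τ.pathFrame i) (τ.pathFrame i) z) (a + b) :=
    HasSum.sum ha hb
  rcases le_or_gt β.length α.length with h | h
  · simpa only [add_zero] using hasSum_pathFrame (τ.hasSum_thetaLin_pathVec h) <|
      hasSum_zero.congr_fun fun μ => τ.thetaLin_normalizedPathStar_eq_zero fun _ =>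
        τ.thetaLin_pathStarVec_of_length_ne (by lia)
  · simpa only [zero_add] using hasSum_pathFrame
      (hasSum_zero.congr_fun fun μ => τ.thetaLin_pathVec_of_length_ne (by lia))
      (τ.hasSum_thetaLin_normalizedPathStar hfin hsrc h)

theorem isFrame_pathFrame (hfin : G.LocallyFinite) (hsrc : G.NoSources) :
    τ.IsFrame τ.pathFrame :=
  τ.Xc_induction (P := fun z => HasSum (fun i => τ.thetaLin (τ.pathFrame i) (τ.pathFrame i) z) z)
    (τ.hasSum_thetaLin_pathFrame hfin hsrc) (by simp)
    (fun x y hx hy => by simpa using hx.add hy) (fun c x hx => by simpa using hx.const_smul c)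

lemma omega_eq_inner_add_inner (μ : G.FinPath) (T : τ.L2 →L[ℂ] τ.L2) :
    τ.omega μ T = inner ℂ (τ.pathVec μ : τ.L2) (T (τ.pathVec μ)) +
      inner ℂ (τ.normalizedPathStar μ : τ.L2) (T (τ.normalizedPathStar μ)) := by
  rw [omega, normalizedPathStar]
  split_ifs with h
  · rw [Completion.coe_zero, inner_zero_left, add_zero]
  · rw [Completion.coe_smul, map_smul, inner_smul_left, inner_smul_right, ← mul_assoc,
      Complex.conj_ofReal, ← Complex.ofReal_mul, ← mul_inv, Real.mul_self_sqrt (Nat.cast_nonneg _),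
      Complex.ofReal_inv, Complex.ofReal_natCast, one_div]

theorem tilde_eq_vectorWeight :
    τ.tilde = vectorWeight τ.vonNeumann fun i => (τ.pathFrame i : τ.L2) := by
  funext T
  have hT : 0 ≤ T.1.1 := T.2
  rw [vectorWeight, Summable.tsum_sum ENNReal.summable ENNReal.summable, ← ENNReal.tsum_add, tilde]
  refine tsum_congr fun μ => ?_
  rw [omega_eq_inner_add_inner, Complex.add_re,
    ENNReal.ofReal_add (re_inner_apply_nonneg hT _) (re_inner_apply_nonneg hT _)]
  rfl

end RowFiniteGraph.GaugeTrace

theorem proposition5p7_general {V E : Type*}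
    (G : RowFiniteGraph V E) (hfin : G.LocallyFinite) (hsrc : G.NoSources) (τ : G.GaugeTrace) :
    IsTrace τ.tilde ∧
    IsFaithfulWeight τ.tilde ∧
    IsNormalWeight τ.vonNeumann τ.tilde ∧
    IsSemifiniteWeight τ.vonNeumann τ.tilde ∧
    (∀ T ∈ τ.finiteRank, ∃ hT : T ∈ τ.vonNeumann.toStarSubalgebra,
      (⟨T, hT⟩ : τ.vonNeumann.toStarSubalgebra) ∈ weightDomain τ.tilde) ∧
    (∀ x y : τ.Xc, ∃ hT : τ.theta x y ∈ τ.vonNeumann.toStarSubalgebra,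
      weightExt τ.tilde ⟨τ.theta x y, hT⟩ = inner ℂ (y : τ.L2) (x : τ.L2) ∧
      inner ℂ (y : τ.L2) (x : τ.L2) = τ.ext (star (τ.val y) * τ.val x)) := by
  have hframe : τ.IsFrame τ.pathFrame := τ.isFrame_pathFrame hfin hsrc
  have inner_eq_ext (x y : τ.Xc) :
      inner ℂ (y : τ.L2) (x : τ.L2) = τ.ext (star (τ.val y) * τ.val x) :=
    UniformSpace.Completion.inner_coe y x
  have weightExt_theta (x y : τ.Xc) : weightExt (vectorWeight τ.vonNeumann
      fun i => (τ.pathFrame i : τ.L2)) (τ.thetaVN x y) = inner ℂ (y : τ.L2) (x : τ.L2) := by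
    rw [UniformSpace.Completion.inner_coe, hframe.weightExt_thetaVN]
  rw [τ.tilde_eq_vectorWeight]
  exact ⟨hframe.isTrace_vectorWeight, hframe.isFaithfulWeight_vectorWeight,
    isNormalWeight_vectorWeight _ _, hframe.isSemifiniteWeight_vectorWeight,
    fun _ => hframe.mem_weightDomain_of_mem_finiteRank,
    fun x y => ⟨τ.theta_mem x y, weightExt_theta x y, inner_eq_ext x y⟩⟩

/-- For a countable, locally finite directed graph `G` without sources and a faithful, semifinite, norm
lower-semicontinuous, gauge invariant trace `τ` on `C^*(G)`, the functional `τ̃` is a faithful normal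
semifinite trace on `N = (End^{00}_F(X_c))''`, its domain of definition contains `End^{00}_F(X_c)`, and
`τ̃(Θ_{x,y}) = ⟨y, x⟩ = τ(y^* x)`. -/
theorem proposition5p7 {V E : Type*} [Countable V] [Countable E]
    (G : RowFiniteGraph V E) (hfin : G.LocallyFinite) (hsrc : G.NoSources) (τ : G.GaugeTrace) :
    IsTrace τ.tilde ∧
    IsFaithfulWeight τ.tilde ∧
    IsNormalWeight τ.vonNeumann τ.tilde ∧
    IsSemifiniteWeight τ.vonNeumann τ.tilde ∧
    (∀ T ∈ τ.finiteRank, ∃ hT : T ∈ τ.vonNeumann.toStarSubalgebra,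
      (⟨T, hT⟩ : τ.vonNeumann.toStarSubalgebra) ∈ weightDomain τ.tilde) ∧
    (∀ x y : τ.Xc, ∃ hT : τ.theta x y ∈ τ.vonNeumann.toStarSubalgebra,
      weightExt τ.tilde ⟨τ.theta x y, hT⟩ = inner ℂ (y : τ.L2) (x : τ.L2) ∧
      inner ℂ (y : τ.L2) (x : τ.L2) = τ.ext (star (τ.val y) * τ.val x)) := by
  exact proposition5p7_general G hfin hsrc τ
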